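/- Let $W$ be a one-dimensional real-valued Brownian motion on a probability space $(\Omega,\mathscr F,\mathbb P)$, let $s>\tfrac12$, let $\sigma\ge 0$ be an integer, let $T>0$, $N\in\mathbb N^+$, $\delta t=T/N$, $t_n=n\,\delta t$ and $\delta W_n=W(t_{n+1})-W(t_n)$. For $r\in\mathbb R$ let $\exp(\mathrm i r\Delta)$ be the Fourier multiplier on $L^2=L^2(\mathbb R;\mathbb C)$ with symbol $e^{-\mathrm i r|2\pi\xi|^2}$, where $\hat u(\xi)=\int u(x)e^{-2\pi \mathrm i x\xi}\,dx$. The Lie splitting scheme for $\mathrm i\,du+\Delta u\circ dW+|u|^{2\sigma}u\,dt=0$ with initial value $u^0\in L^2$ is $$\tilde u^n=\exp(\mathrm i\,\delta t\,|u^n|^{2\sigma})\,u^n,\qquad u^{n+1}=\exp(\mathrm i\,\delta W_n\,\Delta)\,\tilde u^n,\qquad 0\le n\le N-1 .$$ Let $Q(u)=\int_{\mathbb R}|u|^2\,dx$ and write $u^n=p^n+\mathrm i q^n$ with $p^n,q^n$ real. (1) Almost surely, for $0\le n\le N$ the map $u^0\mapsto u^n$ sends $H^s(\mathbb R;\mathbb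 C)$ to itself and is (real) Fréchet differentiable there. Let $\bar\omega^n=\int_{\mathbb R}dp^n\wedge dq^n\,dx$ be the two-form on $H^s$ given at $u^0$ by $\bar\omega^n(h,k)=\int_{\mathbb R}\big(dp^n(h)\,dq^n(k)-dp^n(k)\,dq^n(h)\big)\,dx$ for $h,k\in H^s$, where $dp^n,dq^n$ are the differentials of $p^n,q^n$ with respect to $u^0$. Then, almost surely, $$\bar\omega^{n+1}=\bar\omega^n \ \text{ on } H^s,\qquad Q(u^{n+1})=Q(u^n)\ \text{ for all } u^0\in L^2,\qquad 0\le n\le N-1 .$$ (2) Each substep is the exact flow of an infinite-dimensional Hamiltonian system, $\dot p=-\frac{\delta H}{\delta q}$, $\dot q=\frac{\delta H}{\delta p}$, with respect to time $t$ for $H=H_2:=\frac1{2\sigma+2}\int_{\mathbb R}|u|^{2\sigma+2}dx$ and driven by $W$ for $H=H_1:=-\frac12\int_{\mathbb R}|\nabla u|^2dx$. Precisely: (a) for $u_0\in H^s$ the curve $u(t)=\exp(\mathrm i t|u_0|^{2\sigma})u_0$, $t\in\mathbb R$, is differentiable in $H^s$, $u(0)=u_0$, and $u'=\mathrm i|u|^{2\sigma}u$,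 where $|u|^{2\sigma}u=\frac{\delta H_2}{\delta p}(u)+\mathrm i\frac{\delta H_2}{\delta q}(u)$; (b) for $u^0\in L^2$ and $0\le n\le N-1$ the process $u(t)=\exp\big(\mathrm i(W(t)-W(t_n))\Delta\big)\tilde u^n$ has almost surely continuous paths in $L^2$ on $[t_n,t_{n+1}]$ and satisfies $du=\mathrm i\Delta u\circ dW$ there, in integrated form and in the sense of tempered distributions, the Stratonovich integral being the limit in probability of trapezoidal sums; and for $v\in H^2$ the curve $v(r)=\exp(\mathrm i r\Delta)v$, $r\in\mathbb R$, is differentiable in $L^2$, $v(0)=v$, and $v'=\mathrm i\Delta v$, where $\Delta v=\frac{\delta H_1}{\delta p}(v)+\mathrm i\frac{\delta H_1}{\delta q}(v)$. Here variational derivatives are taken in the directions of Schwartz functions. (3) For each $\tau,r\in\mathbb R$ and $f\in L^2$, multiplication by $\exp(\mathrm i\tau|f|^{2\sigma})$ and $\exp(\mathrm i r\Delta)$ are unitary operators on $L^2$. -/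

import Mathlib

open MeasureTheory ProbabilityTheory TemperedDistribution
open scoped NNReal ENNReal SchwartzMap FourierTransform Laplacian LineDeriv

noncomputable section

namespace WhiteNoiseNLS

/-- The complex Hilbert space `L²(ℝ; ℂ)`. -/
abbrev L2 : Type := Lp ℂ 2 (volume : Measure ℝ)

/-! ### The Sobolev space `H^s(ℝ; ℂ)` with its norm -/

/-- The square integrable functions that belong to the Sobolev space of order `s`. -/
def sobolevSubmodule (s : ℝ) : Submodule ℂ L2 where
  carrier := {f | MemSobolev s 2 (f : 𝓢'(ℝ, ℂ))}
  add_mem' {f g} hf hg := by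
    have h := MemSobolev.add hf hg
    simp only [← Lp.toTemperedDistributionCLM_apply, ← map_add] at h
    exact h
  zero_mem' := by
    have h := memSobolev_fun_zero ℝ ℂ s 2
    rw [← map_zero (Lp.toTemperedDistributionCLM ℂ (volume : Measure ℝ) 2)] at h
    exact h
  smul_mem' c f hf := by
    have h := MemSobolev.smul c hf
    simp only [← Lp.toTemperedDistributionCLM_apply, ← map_smul] at h
    exact h

/-- `H^s(ℝ; ℂ)` for `s ≥ 0`. It is a type of its own because it does not carry the norm of `L²`. -/
def Hs (s : ℝ) : Type := sobolevSubmodule s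

instance (s : ℝ) : AddCommGroup (Hs s) := inferInstanceAs (AddCommGroup (sobolevSubmodule s))

instance (s : ℝ) : Module ℂ (Hs s) := inferInstanceAs (Module ℂ (sobolevSubmodule s))

/-- The inclusion of `H^s` in `L²`. -/
def Hs.toL2 {s : ℝ} : Hs s →ₗ[ℂ] L2 := (sobolevSubmodule s).subtype

theorem Hs.toL2_injective {s : ℝ} : Function.Injective (Hs.toL2 (s := s)) :=
  Subtype.val_injective

theorem Hs.memSobolev {s : ℝ} (u : Hs s) : MemSobolev s 2 (u.toL2 : 𝓢'(ℝ, ℂ)) := u.2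

theorem toTemperedDistribution_injective {f g : L2}
    (h : (f : 𝓢'(ℝ, ℂ)) = (g : 𝓢'(ℝ, ℂ))) : f = g := by
  have hk := Lp.ker_toTemperedDistributionCLM_eq_bot (F := ℂ) (μ := (volume : Measure ℝ)) (p := 2)
  exact LinearMap.ker_eq_bot.mp hk h

/-- The function `𝓕⁻¹ ((1 + |ξ|²)^{s/2} 𝓕 u)`. -/
def Hs.besselFun {s : ℝ} (u : Hs s) : L2 := Classical.choose u.memSobolev

theorem Hs.besselFun_spec {s : ℝ} (u : Hs s) :
    besselPotential ℝ ℂ s (u.toL2 : 𝓢'(ℝ, ℂ)) = (u.besselFun : 𝓢'(ℝ, ℂ)) :=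
  Classical.choose_spec u.memSobolev

theorem Hs.besselFun_eq {s : ℝ} (u : Hs s) {f : L2}
    (h : besselPotential ℝ ℂ s (u.toL2 : 𝓢'(ℝ, ℂ)) = (f : 𝓢'(ℝ, ℂ))) : u.besselFun = f :=
  toTemperedDistribution_injective (u.besselFun_spec.symm.trans h)

/-- The map `u ↦ 𝓕⁻¹ ((1 + |ξ|²)^{s/2} 𝓕 u)` from `H^s` to `L²`. -/
def Hs.bessel {s : ℝ} : Hs s →ₗ[ℂ] L2 where
  toFun u := u.besselFun
  map_add' u v := by
    apply Hs.besselFun_eq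
    have hu := u.besselFun_spec
    have hv := v.besselFun_spec
    rw [← Lp.toTemperedDistributionCLM_apply] at hu hv ⊢
    rw [← Lp.toTemperedDistributionCLM_apply] at hu hv ⊢
    rw [map_add, map_add, map_add, hu, hv]
    exact (map_add _ _ _).symm
  map_smul' c u := by
    apply Hs.besselFun_eq
    have hu := u.besselFun_spec
    rw [← Lp.toTemperedDistributionCLM_apply] at hu ⊢
    rw [← Lp.toTemperedDistributionCLM_apply] at hu ⊢
    rw [map_smul, map_smul, map_smul, hu, RingHom.id_apply]
    exact (map_smul _ _ _).symm

theorem Hs.bessel_spec {s : ℝ} (u : Hs s) :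
    besselPotential ℝ ℂ s (u.toL2 : 𝓢'(ℝ, ℂ)) = (u.bessel : 𝓢'(ℝ, ℂ)) :=
  u.besselFun_spec

theorem Hs.bessel_injective {s : ℝ} : Function.Injective (Hs.bessel (s := s)) := by
  intro u v h
  apply Hs.toL2_injective
  apply toTemperedDistribution_injective
  have h1 := Hs.bessel_spec u
  rw [h, ← Hs.bessel_spec v] at h1
  have h2 := congrArg (besselPotential ℝ ℂ (-s)) h1
  simpa using h2

/-- The norm of `H^s` is `‖u‖ = ‖(1 + |ξ|²)^{s/2} 𝓕 u‖` in `L²`. -/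
instance (s : ℝ) : NormedAddCommGroup (Hs s) :=
  NormedAddCommGroup.induced (Hs s) L2 Hs.bessel Hs.bessel_injective

instance (s : ℝ) : NormedSpace ℂ (Hs s) :=
  NormedSpace.induced ℂ (Hs s) L2 Hs.bessel

/-! ### The Lie splitting scheme -/

theorem memLp_phase (θ : ℝ → ℝ) (hθ : AEMeasurable θ) (f : L2) :
    MemLp (fun x => Complex.exp (Complex.I * (θ x : ℂ)) * f x) 2 (volume : Measure ℝ) := by
  refine MemLp.of_le (Lp.memLp f) ?_ (Filter.Eventually.of_forall fun x => ?_)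
  · have h : AEMeasurable (fun x => Complex.exp (Complex.I * (θ x : ℂ))) (volume : Measure ℝ) := by
      fun_prop
    exact h.aestronglyMeasurable.mul (Lp.aestronglyMeasurable f)
  · rw [norm_mul, mul_comm Complex.I, Complex.norm_exp_ofReal_mul_I, one_mul]

/-- Multiplication by `exp(i θ)`. -/
def phaseMul (θ : ℝ → ℝ) (hθ : AEMeasurable θ) (f : L2) : L2 := (memLp_phase θ hθ f).toLp

theorem aemeasurable_nlPhase (σ : ℕ) (τ : ℝ) (f : L2) :
    AEMeasurable (fun x => τ * ‖f x‖ ^ (2 * σ)) := by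
  have h := (Lp.aestronglyMeasurable f).aemeasurable
  fun_prop

theorem aemeasurable_freePhase (r : ℝ) :
    AEMeasurable (fun ξ : ℝ => -r * (2 * Real.pi * ξ) ^ 2) := by
  fun_prop

/-- The nonlinear substep `u ↦ exp(i τ |u|^{2σ}) u`. -/
def nlStep (σ : ℕ) (τ : ℝ) (f : L2) : L2 :=
  phaseMul (fun x => τ * ‖f x‖ ^ (2 * σ)) (aemeasurable_nlPhase σ τ f) f

/-- The linear substep `exp(i r Δ)`, the Fourier multiplier with symbol `exp(-i r (2 π ξ)²)`. -/
def freeStep (r : ℝ) (f : L2) : L2 :=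
  𝓕⁻ (phaseMul (fun ξ => -r * (2 * Real.pi * ξ) ^ 2) (aemeasurable_freePhase r) (𝓕 f))

/-- The grid point `t_n = n T / N`. -/
def gridTime (T : ℝ≥0) (N n : ℕ) : ℝ≥0 := n * T / N

/-- The increment `W(t_{n+1}) - W(t_n)` of the path `w`. -/
def increment (w : ℝ≥0 → ℝ) (T : ℝ≥0) (N n : ℕ) : ℝ :=
  w (gridTime T N (n + 1)) - w (gridTime T N n)

/-- The value `u^n` of the Lie splitting scheme along the driving path `w`, started at `u⁰ = u₀`. -/
def lieScheme (σ : ℕ) (T : ℝ≥0) (N : ℕ) (w : ℝ≥0 → ℝ) : ℕ → L2 → L2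
  | 0, u₀ => u₀
  | n + 1, u₀ =>
    freeStep (increment w T N n) (nlStep σ ((T : ℝ) / N) (lieScheme σ T N w n u₀))

/-- The intermediate value `exp(i δt |u^n|^{2σ}) u^n` of the scheme. -/
def lieIntermediate (σ : ℕ) (T : ℝ≥0) (N : ℕ) (w : ℝ≥0 → ℝ) (n : ℕ) (u₀ : L2) : L2 :=
  nlStep σ ((T : ℝ) / N) (lieScheme σ T N w n u₀)

/-! ### The charge and the symplectic structure -/

/-- The charge `Q(u) = ∫ |u|² dx`. -/
def charge (f : L2) : ℝ := ∫ x, ‖f x‖ ^ 2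

/-- The value of `∫ dp ∧ dq dx` on two tangent vectors `h` and `k`. -/
def symplecticForm (h k : L2) : ℝ := ∫ x, ((h x).re * (k x).im - (k x).re * (h x).im)

/-- The two-form `ω̄^n = ∫ dp^n ∧ dq^n dx` on the phase space `H^s`, at the initial value `u` and on
the tangent vectors `h`, `k`; the differential is the Fréchet derivative of `u⁰ ↦ u^n = p^n + i q^n`
with respect to the initial value, over the real numbers. -/
def schemeForm (s : ℝ) (σ : ℕ) (T : ℝ≥0) (N : ℕ) (w : ℝ≥0 → ℝ) (n : ℕ) (u h k : Hs s) : ℝ :=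
  symplecticForm
    (fderiv ℝ (fun v : Hs s => lieScheme σ T N w n v.toL2) u h)
    (fderiv ℝ (fun v : Hs s => lieScheme σ T N w n v.toL2) u k)

/-! ### Hamiltonian systems -/

open Classical in
/-- The distributional derivative of `f` if it is square integrable (and `0` otherwise). -/
def weakDeriv (f : L2) : L2 :=
  if h : ∃ g : L2, ∂_{(1 : ℝ)} (f : 𝓢'(ℝ, ℂ)) = (g : 𝓢'(ℝ, ℂ)) then h.choose else 0

/-- `H₁(u) = -(1/2) ∫ |∇u|² dx`. -/
def energyH1 (f : L2) : ℝ := -(1 / 2) * ∫ x, ‖weakDeriv f x‖ ^ 2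

/-- `H₂(u) = 1/(2σ+2) ∫ |u|^{2σ+2} dx`. -/
def energyH2 (σ : ℕ) (f : L2) : ℝ := 1 / (2 * (σ : ℝ) + 2) * ∫ x, ‖f x‖ ^ (2 * σ + 2)

/-- `g = δH/δp + i δH/δq` at `u = p + i q`: the derivative of `H` at `u` in the direction of each
Schwartz function `φ` is `∫ (δH/δp Re φ + δH/δq Im φ) dx`. -/
def HasVariationalDerivative (H : L2 → ℝ) (u g : L2) : Prop :=
  ∀ φ : 𝓢(ℝ, ℂ), HasDerivAt (fun ε : ℝ => H (u + ε • φ.toLp 2 (volume : Measure ℝ)))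
    (∫ x, ((g x).re * (φ x).re + (g x).im * (φ x).im)) 0

/-! ### The Stratonovich equation `du = i Δu ∘ dW` -/

section

variable {Ω : Type*} [MeasurableSpace Ω]

/-- `J` is the Stratonovich integral `∫_a^b X ∘ dW`: the limit in probability of the trapezoidal
sums over the partitions of `[a, b]` as their mesh tends to `0`. -/
def HasStratonovichIntegral (P : Measure Ω) (W : ℝ≥0 → Ω → ℝ) (X : ℝ≥0 → Ω → ℂ) (a b : ℝ≥0)
    (J : Ω → ℂ) : Prop :=
  ∀ ε : ℝ, 0 < ε → ∀ η : ℝ, 0 < η → ∃ δ : ℝ, 0 < δ ∧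
    ∀ (m : ℕ) (τ : ℕ → ℝ≥0), Monotone τ → τ 0 = a → τ m = b →
      (∀ i < m, (τ (i + 1) : ℝ) - τ i ≤ δ) →
      P {ω | ε ≤ ‖(∑ i ∈ Finset.range m, (X (τ i) ω + X (τ (i + 1)) ω) / 2 *
        ((W (τ (i + 1)) ω - W (τ i) ω : ℝ) : ℂ)) - J ω‖} ≤ ENNReal.ofReal η

/-- The process `u` has almost surely continuous paths in `L²` on `[a, b]` and satisfies
`u(t) = u(a) + ∫_a^t i Δu ∘ dW` for `a ≤ t ≤ b` in the sense of tempered distributions. -/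
def SolvesLinearEquation (P : Measure Ω) (W : ℝ≥0 → Ω → ℝ) (a b : ℝ≥0) (u : ℝ≥0 → Ω → L2) :
    Prop :=
  (∀ᵐ ω ∂P, ContinuousOn (fun t => u t ω) (Set.Icc a b)) ∧
  ∀ t ∈ Set.Icc a b, ∀ φ : 𝓢(ℝ, ℂ),
    HasStratonovichIntegral P W
      (fun r ω => Complex.I * (Δ (u r ω : 𝓢'(ℝ, ℂ))) φ) a t
      (fun ω => (u t ω : 𝓢'(ℝ, ℂ)) φ - (u a ω : 𝓢'(ℝ, ℂ)) φ)

end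

end WhiteNoiseNLS

end

open WhiteNoiseNLS

noncomputable section

namespace WhiteNoiseNLS

/-! ### The Fourier transform on `L²` -/

/-! The path of `W` enters the scheme only through its increments, which are real numbers, so the
symplectic and charge statements hold for every path; probability is used only for the Stratonovich
equation.

For `s > 1/2` the space `H^s` is an algebra (`Hs.exists_mul`) stable under conjugation
(`Hs.exists_conj`). Hence multiplication by `|u|^{2σ}` is a bounded operator built polynomially from
`u` and its conjugate, and the nonlinear substep is an operator exponential applied to `u`. This
makes it real differentiable in `u` and differentiable in time. Abstract derivatives are then
identified with pointwise ones, because convergence in `L²` gives almost everywhere convergence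
along a subsequence (`coeFn_ae_eq_of_hasDerivAt`).

Pointwise, the differential of `z ↦ exp(iτ|z|^{2σ}) z` is an area preserving linear map of the plane
(`nlDeriv_symplectic`), and the two-form is the imaginary part of the `L²` inner product, which the
unitary linear substep preserves. The chain rule combines the two. The charge is the squared norm,
preserved by both substeps. Since `|u|` does not change along the nonlinear substep, the frozen
phase gives the exact flow of `H₂`; the flow of `H₁` is computed by Plancherel and dominated
convergence.

For the stochastic equation no Itô calculus is needed. Tested against a Schwartz function, the
solution is a smooth function of the real variable `W(t) - W(t_n)`, and the trapezoidal rule has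
local error `O(|δW|³)` (`norm_freeStep_trapezoid_le`). The expected sum of the cubes is at most a
constant times the square root of the mesh, and Markov's inequality gives convergence in
probability. -/

theorem ae_eq_of_integral_schwartz_mul_eq {f g : ℝ → ℂ} (hf : LocallyIntegrable f)
    (hg : LocallyIntegrable g)
    (h : ∀ φ : 𝓢(ℝ, ℂ), ∫ x, φ x * f x = ∫ x, φ x * g x) : f =ᵐ[volume] g := by
  refine ae_eq_of_integral_contDiff_smul_eq hf hg fun θ hθ hθc => ?_
  have h1 : HasCompactSupport (Complex.ofRealCLM ∘ θ) := hθc.comp_left rfl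
  have h2 : ContDiff ℝ ((⊤ : ℕ∞) : WithTop ℕ∞) (Complex.ofRealCLM ∘ θ) := by fun_prop
  simpa using h (h1.toSchwartzMap h2)

theorem locallyIntegrable_coeFn (f : L2) : LocallyIntegrable f :=
  (Lp.memLp f).locallyIntegrable (by norm_num)

theorem integral_schwartz_mul_fourier (f : L2) (φ : 𝓢(ℝ, ℂ)) :
    ∫ x, φ x * (𝓕 f : L2) x = ∫ x, (𝓕 φ) x * f x := by
  have h := congrArg (fun T : 𝓢'(ℝ, ℂ) => T φ) (Lp.fourier_toTemperedDistribution_eq f)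
  simpa using h.symm

theorem integral_schwartz_mul_fourierInv (f : L2) (φ : 𝓢(ℝ, ℂ)) :
    ∫ x, φ x * (𝓕⁻ f : L2) x = ∫ x, (𝓕⁻ φ) x * f x := by
  have h := congrArg (fun T : 𝓢'(ℝ, ℂ) => T φ) (Lp.fourierInv_toTemperedDistribution_eq f)
  simpa using h.symm

/-- Fubini for the pairing `-innerₗ ℝ`, whose sign produces the inverse transform; the pairing is
symmetric, so flipping it changes nothing. -/
theorem integral_fourierInv_mul_eq_flip {f g : ℝ → ℂ} (hf : Integrable f) (hg : Integrable g) :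
    ∫ x, 𝓕⁻ f x * g x = ∫ x, f x * 𝓕⁻ g x := by
  have h := VectorFourier.integral_fourierIntegral_smul_eq_flip (L := -innerₗ ℝ)
    (μ := (volume : Measure ℝ)) (ν := (volume : Measure ℝ)) (e := Real.fourierChar)
    Real.continuous_fourierChar
    (by simp only [LinearMap.neg_apply, innerₗ_apply_apply]; fun_prop) hf hg
  have hfl : (-innerₗ ℝ).flip = -innerₗ ℝ := by
    ext; simp
  rw [hfl] at h
  exact h

/-- On integrable square integrable functions the inverse Fourier transform is given by the
integral. -/
theorem coeFn_fourierInv_of_integrable {f : L2} (hf : Integrable f) :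
    (𝓕⁻ f : L2) =ᵐ[volume] 𝓕⁻ (f : ℝ → ℂ) := by
  have hc : Continuous (𝓕⁻ (f : ℝ → ℂ)) :=
    VectorFourier.fourierIntegral_continuous Real.continuous_fourierChar
      (by simp only [LinearMap.neg_apply, innerₗ_apply_apply]; fun_prop) hf
  refine ae_eq_of_integral_schwartz_mul_eq (locallyIntegrable_coeFn _) hc.locallyIntegrable ?_
  intro φ
  rw [integral_schwartz_mul_fourierInv, SchwartzMap.fourierInv_coe,
    integral_fourierInv_mul_eq_flip φ.integrable hf]

/-! ### A description of `H^s` on the Fourier side -/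

/-- The weight `(1 + |ξ|²)^{s/2}`. -/
def weight (s ξ : ℝ) : ℝ := (1 + ‖ξ‖ ^ 2) ^ (s / 2)

theorem weight_pos (s ξ : ℝ) : 0 < weight s ξ := by unfold weight; positivity

theorem one_le_weight {s : ℝ} (hs : 0 ≤ s) (ξ : ℝ) : 1 ≤ weight s ξ :=
  Real.one_le_rpow (by nlinarith [sq_nonneg ‖ξ‖]) (by linarith)

theorem weight_neg_arg (s ξ : ℝ) : weight s (-ξ) = weight s ξ := by simp [weight]

theorem weight_neg_mul (s ξ : ℝ) : weight (-s) ξ * weight s ξ = 1 := by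
  unfold weight
  rw [← Real.rpow_add (by positivity)]
  ring_nf
  simp

theorem hasTemperateGrowth_weight (s : ℝ) :
    (fun ξ : ℝ => ((weight s ξ : ℝ) : ℂ)).HasTemperateGrowth := by
  unfold weight; fun_prop

theorem continuous_weight (s : ℝ) : Continuous (weight s) := by
  unfold weight
  exact Continuous.rpow_const (by fun_prop) fun x => Or.inl (by positivity)

/-- If `|b| ≤ |a|` then `1 + |a + b|² ≤ 4 (1 + |a|²)`, and `4^{s/2} = 2^s`. This replaces the
Leibniz rule in the algebra property. -/
theorem weight_add_le {s : ℝ} (hs : 0 ≤ s) (a b : ℝ) :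
    weight s (a + b) ≤ 2 ^ s * (weight s a + weight s b) := by
  wlog hab : ‖b‖ ≤ ‖a‖ generalizing a b
  · rw [add_comm a b, add_comm (weight s a)]
    exact this b a (le_of_not_ge hab)
  have h1 : weight s (a + b) ≤ 2 ^ s * weight s a := by
    unfold weight
    have h4 : (2 : ℝ) ^ s = 4 ^ (s / 2) := by
      rw [show (4 : ℝ) = 2 ^ (2 : ℝ) by norm_num, ← Real.rpow_mul (by norm_num)]
      ring_nf
    rw [h4, ← Real.mul_rpow (by norm_num) (by positivity)]
    refine Real.rpow_le_rpow (by positivity) ?_ (by linarith)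
    have := norm_add_le a b
    nlinarith [norm_nonneg a, norm_nonneg b, norm_nonneg (a + b)]
  have h2 := weight_pos s b
  have h3 : (0 : ℝ) < 2 ^ s := by positivity
  nlinarith [mul_pos h3 h2]

/-- Replaces the distributional definition of `H^s` by an almost everywhere identity between Fourier
transforms, obtained by testing against Schwartz functions. -/
theorem besselPotential_eq_iff {s : ℝ} {f g : L2} :
    besselPotential ℝ ℂ s (f : 𝓢'(ℝ, ℂ)) = (g : 𝓢'(ℝ, ℂ)) ↔
      (𝓕 g : L2) =ᵐ[volume] fun ξ => (weight s ξ : ℂ) * (𝓕 f : L2) ξ := by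
  have hloc : LocallyIntegrable (fun ξ => (weight s ξ : ℂ) * (𝓕 f : L2) ξ) := by
    have hw : Continuous fun ξ => (weight s ξ : ℂ) :=
      Complex.continuous_ofReal.comp (continuous_weight s)
    have := (locallyIntegrable_coeFn (𝓕 f)).locallyIntegrableOn Set.univ
    rw [← locallyIntegrableOn_univ]
    exact this.continuousOn_mul hw.continuousOn isOpen_univ.isLocallyClosed
  have key : ∀ φ : 𝓢(ℝ, ℂ), 𝓕 (besselPotential ℝ ℂ s (f : 𝓢'(ℝ, ℂ))) φ =
      ∫ ξ, φ ξ * ((weight s ξ : ℂ) * (𝓕 f : L2) ξ) := by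
    intro φ
    rw [fourier_besselPotential_eq_smulLeftCLM_fourier_apply, smulLeftCLM_apply_apply,
      Lp.fourier_toTemperedDistribution_eq, Lp.toTemperedDistribution_apply]
    refine integral_congr_ae (Filter.Eventually.of_forall fun ξ => ?_)
    simp only [weight, smul_eq_mul]
    have := SchwartzMap.smulLeftCLM_apply_apply (hasTemperateGrowth_weight s) φ ξ
    simp only [weight, smul_eq_mul] at this
    rw [this]
    ring
  constructor
  · intro h
    refine ae_eq_of_integral_schwartz_mul_eq (locallyIntegrable_coeFn _) hloc fun φ => ?_
    rw [← key, h, Lp.fourier_toTemperedDistribution_eq, Lp.toTemperedDistribution_apply]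
    rfl
  · intro h
    have hinj : Function.Injective (𝓕 : 𝓢'(ℝ, ℂ) → 𝓢'(ℝ, ℂ)) :=
      Function.LeftInverse.injective (g := (𝓕⁻ : 𝓢'(ℝ, ℂ) → 𝓢'(ℝ, ℂ)))
        FourierTransform.fourierInv_fourier_eq
    apply hinj
    ext φ
    rw [key, Lp.fourier_toTemperedDistribution_eq, Lp.toTemperedDistribution_apply]
    refine integral_congr_ae ?_
    filter_upwards [h] with ξ hξ
    rw [hξ, smul_eq_mul]

theorem Hs.fourier_bessel {s : ℝ} (u : Hs s) :
    (𝓕 u.bessel : L2) =ᵐ[volume] fun ξ => (weight s ξ : ℂ) * (𝓕 u.toL2 : L2) ξ :=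
  besselPotential_eq_iff.mp u.bessel_spec

theorem Hs.norm_eq_norm_bessel {s : ℝ} (u : Hs s) : ‖u‖ = ‖u.bessel‖ := rfl

/-- The function of `H^s` with given Fourier transform. -/
theorem Hs.exists_of_fourier {s : ℝ} {f : L2}
    (h : MemLp (fun ξ => (weight s ξ : ℂ) * (𝓕 f : L2) ξ) 2 (volume : Measure ℝ)) :
    ∃ u : Hs s, u.toL2 = f ∧ u.bessel = 𝓕⁻ h.toLp := by
  have h1 : besselPotential ℝ ℂ s (f : 𝓢'(ℝ, ℂ)) = ((𝓕⁻ h.toLp : L2) : 𝓢'(ℝ, ℂ)) := by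
    rw [besselPotential_eq_iff, FourierTransform.fourier_fourierInv_eq]
    exact h.coeFn_toLp
  have hm : f ∈ sobolevSubmodule s := ⟨_, h1⟩
  refine ⟨⟨f, hm⟩, rfl, ?_⟩
  exact Hs.besselFun_eq _ h1

theorem Hs.memLp_weight_mul_fourier {s : ℝ} (u : Hs s) :
    MemLp (fun ξ => (weight s ξ : ℂ) * (𝓕 u.toL2 : L2) ξ) 2 (volume : Measure ℝ) :=
  (Lp.memLp (𝓕 u.bessel : L2)).ae_eq u.fourier_bessel

theorem Hs.enorm_eq {s : ℝ} (u : Hs s) :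
    ENNReal.ofReal ‖u‖ =
      eLpNorm (fun ξ => (weight s ξ : ℂ) * (𝓕 u.toL2 : L2) ξ) 2 (volume : Measure ℝ) := by
  rw [u.norm_eq_norm_bessel, ← Lp.norm_fourier_eq, Lp.norm_def,
    ENNReal.ofReal_toReal (Lp.eLpNorm_ne_top _)]
  exact eLpNorm_congr_ae u.fourier_bessel

/-- Integrability of `G` makes the inverse transform an honest integral, so that products and
conjugates can be recognised pointwise. -/
theorem Hs.exists_of_integrable {s : ℝ} (hs : 0 ≤ s) {G : ℝ → ℂ} (hG : Integrable G)
    (h : MemLp (fun ξ => (weight s ξ : ℂ) * G ξ) 2 (volume : Measure ℝ)) :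
    ∃ u : Hs s, u.toL2 =ᵐ[volume] 𝓕⁻ G ∧ (𝓕 u.toL2 : L2) =ᵐ[volume] G := by
  have hG2 : MemLp G 2 (volume : Measure ℝ) := by
    refine h.of_le hG.aestronglyMeasurable (Filter.Eventually.of_forall fun ξ => ?_)
    rw [norm_mul, Complex.norm_real, Real.norm_of_nonneg (weight_pos s ξ).le]
    nlinarith [one_le_weight hs ξ, norm_nonneg (G ξ)]
  have hf : (𝓕 (𝓕⁻ hG2.toLp : L2) : L2) =ᵐ[volume] G := by
    rw [FourierTransform.fourier_fourierInv_eq]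
    exact hG2.coeFn_toLp
  obtain ⟨u, hu, -⟩ := Hs.exists_of_fourier (s := s) (f := 𝓕⁻ hG2.toLp)
    (h.ae_eq (by filter_upwards [hf] with ξ hξ; rw [hξ]))
  refine ⟨u, ?_, hu ▸ hf⟩
  rw [hu]
  have hi : Integrable (hG2.toLp : L2) := hG.congr hG2.coeFn_toLp.symm
  refine (coeFn_fourierInv_of_integrable hi).trans (Filter.Eventually.of_forall fun x => ?_)
  rw [Real.fourierInv_eq', Real.fourierInv_eq']
  refine integral_congr_ae ?_
  filter_upwards [hG2.coeFn_toLp] with ξ hξ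
  rw [hξ]

theorem Hs.norm_toL2_le {s : ℝ} (hs : 0 ≤ s) (u : Hs s) : ‖u.toL2‖ ≤ ‖u‖ := by
  rw [u.norm_eq_norm_bessel, ← Lp.norm_fourier_eq, ← Lp.norm_fourier_eq u.bessel]
  refine Lp.norm_le_norm_of_ae_le ?_
  filter_upwards [u.fourier_bessel] with ξ hξ
  rw [hξ, norm_mul, Complex.norm_real, Real.norm_of_nonneg (weight_pos s ξ).le]
  nlinarith [one_le_weight hs ξ, norm_nonneg ((𝓕 u.toL2 : L2) ξ)]

/-- The continuous inclusion of `H^s` in `L²`. -/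
def Hs.toL2CLM {s : ℝ} (hs : 0 ≤ s) : Hs s →L[ℂ] L2 :=
  Hs.toL2.mkContinuous 1 fun u => by simpa using u.norm_toL2_le hs

/-- A preimage is obtained by dividing by the weight, which is at least `1`. The isometry
`Hs.bessel` then transfers completeness from `L²`, which the operator exponential requires. -/
theorem Hs.bessel_surjective {s : ℝ} (hs : 0 ≤ s) : Function.Surjective (Hs.bessel (s := s)) := by
  intro g
  have h1 : MemLp (fun ξ => (weight (-s) ξ : ℂ) * (𝓕 g : L2) ξ) 2 (volume : Measure ℝ) := by
    refine (Lp.memLp (𝓕 g : L2)).of_le ?_ (Filter.Eventually.of_forall fun ξ => ?_)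
    · exact (Complex.continuous_ofReal.comp (continuous_weight (-s))).aestronglyMeasurable.mul
        (Lp.aestronglyMeasurable _)
    · rw [norm_mul, Complex.norm_real, Real.norm_of_nonneg (weight_pos _ ξ).le]
      have := weight_neg_mul s ξ
      have h2 := one_le_weight hs ξ
      have h3 : weight (-s) ξ ≤ 1 := by nlinarith [weight_pos (-s) ξ]
      nlinarith [norm_nonneg ((𝓕 g : L2) ξ)]
  have h2 : besselPotential ℝ ℂ s ((𝓕⁻ h1.toLp : L2) : 𝓢'(ℝ, ℂ)) = (g : 𝓢'(ℝ, ℂ)) := by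
    rw [besselPotential_eq_iff, FourierTransform.fourier_fourierInv_eq]
    filter_upwards [h1.coeFn_toLp] with ξ hξ
    rw [hξ, ← mul_assoc, mul_comm (weight s ξ : ℂ), ← Complex.ofReal_mul, weight_neg_mul]
    simp
  exact ⟨⟨_, ⟨g, h2⟩⟩, Hs.besselFun_eq _ h2⟩

theorem Hs.completeSpace {s : ℝ} (hs : 0 ≤ s) : CompleteSpace (Hs s) := by
  have hi : Isometry (Hs.bessel (s := s)) :=
    AddMonoidHomClass.isometry_of_norm _ fun u => u.norm_eq_norm_bessel.symm
  exact (hi.isUniformInducing.completeSpace_congr (Hs.bessel_surjective hs)).mpr inferInstance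

/-! ### `H^s` is an algebra -/

theorem eLpNorm_two_sq {E : Type*} [NormedAddCommGroup E] (f : ℝ → E) :
    eLpNorm f 2 (volume : Measure ℝ) ^ 2 = ∫⁻ x, ‖f x‖ₑ ^ 2 := by
  have h := eLpNorm_nnreal_pow_eq_lintegral (f := f) (p := 2) (μ := (volume : Measure ℝ))
    (by norm_num)
  simpa using h

/-- Young's inequality for the convolution of an integrable and a square integrable function. -/
theorem lintegral_convolution_sq_le {f g : ℝ → ℝ≥0∞} (hf : AEMeasurable f) (hg : AEMeasurable g) :
    ∫⁻ x, (∫⁻ y, f y * g (x - y)) ^ 2 ≤ (∫⁻ y, f y) ^ 2 * ∫⁻ y, g y ^ 2 := by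
  have hgs : AEMeasurable (fun p : ℝ × ℝ => g (p.1 - p.2)) (volume.prod volume) :=
    hg.comp_quasiMeasurePreserving (quasiMeasurePreserving_sub volume volume)
  have hgx : ∀ x, AEMeasurable (fun y => g (x - y)) := fun x =>
    hg.comp_quasiMeasurePreserving
      (Measure.measurePreserving_sub_left volume x).quasiMeasurePreserving
  -- Cauchy–Schwarz with the splitting `f g = f^{1/2} · (f^{1/2} g)`; Tonelli and translation
  -- invariance finish the proof.
  have cs : ∀ x, (∫⁻ y, f y * g (x - y)) ^ 2 ≤ (∫⁻ y, f y) * ∫⁻ y, f y * g (x - y) ^ 2 := by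
    intro x
    have h := ENNReal.lintegral_mul_le_Lp_mul_Lq (volume : Measure ℝ) Real.HolderConjugate.two_two
      (hf.pow_const (1 / 2 : ℝ)) ((hf.pow_const (1 / 2 : ℝ)).mul (hgx x))
    have e1 : ∀ y, ((fun y => f y ^ (1 / 2 : ℝ)) *
        ((fun y => f y ^ (1 / 2 : ℝ)) * fun y => g (x - y))) y = f y * g (x - y) := by
      intro y
      simp only [Pi.mul_apply]
      rw [← mul_assoc, ← ENNReal.rpow_add_of_nonneg _ _ (by norm_num) (by norm_num)]
      norm_num
    have e2 : ∀ y, (f y ^ (1 / 2 : ℝ)) ^ (2 : ℝ) = f y := by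
      intro y
      rw [← ENNReal.rpow_mul]; norm_num
    have e3 : ∀ y, ((fun y => f y ^ (1 / 2 : ℝ)) * fun y => g (x - y)) y ^ (2 : ℝ) =
        f y * g (x - y) ^ 2 := by
      intro y
      simp only [Pi.mul_apply]
      rw [ENNReal.mul_rpow_of_nonneg _ _ (by norm_num), e2, ENNReal.rpow_two]
    simp only [e1, e2, e3] at h
    calc (∫⁻ y, f y * g (x - y)) ^ 2
        ≤ ((∫⁻ y, f y) ^ (1 / 2 : ℝ) * (∫⁻ y, f y * g (x - y) ^ 2) ^ (1 / 2 : ℝ)) ^ 2 := by gcongr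
      _ = _ := by
        rw [mul_pow, ← ENNReal.rpow_two, ← ENNReal.rpow_two, ← ENNReal.rpow_mul, ← ENNReal.rpow_mul]
        norm_num
  calc ∫⁻ x, (∫⁻ y, f y * g (x - y)) ^ 2
      ≤ ∫⁻ x, (∫⁻ y, f y) * ∫⁻ y, f y * g (x - y) ^ 2 := lintegral_mono cs
    _ = (∫⁻ y, f y) * ∫⁻ x, ∫⁻ y, f y * g (x - y) ^ 2 := by
      refine lintegral_const_mul'' _ ?_
      refine AEMeasurable.lintegral_prod_right' (f := fun p : ℝ × ℝ => f p.2 * g (p.1 - p.2) ^ 2) ?_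
      exact (hf.comp_quasiMeasurePreserving Measure.quasiMeasurePreserving_snd).mul
        (hgs.pow_const 2)
    _ = (∫⁻ y, f y) * ∫⁻ y, ∫⁻ x, f y * g (x - y) ^ 2 := by
      congr 1
      refine lintegral_lintegral_swap ?_
      exact (hf.comp_quasiMeasurePreserving Measure.quasiMeasurePreserving_snd).mul
        (hgs.pow_const 2)
    _ = (∫⁻ y, f y) * ∫⁻ y, f y * ∫⁻ x, g x ^ 2 := by
      congr 2; ext y
      have hy : AEMeasurable (fun x => g (x - y) ^ 2) :=
        (hg.pow_const 2).comp_quasiMeasurePreserving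
          (measurePreserving_sub_right volume y).quasiMeasurePreserving
      rw [lintegral_const_mul'' _ hy, lintegral_sub_right_eq_self (fun x => g x ^ 2) y]
    _ = _ := by
      rw [lintegral_mul_const'' _ hf]; ring

theorem lintegral_convolution_sq_le' {f g : ℝ → ℝ≥0∞} (hf : AEMeasurable f)
    (hg : AEMeasurable g) :
    ∫⁻ x, (∫⁻ y, f y * g (x - y)) ^ 2 ≤ (∫⁻ y, f y ^ 2) * (∫⁻ y, g y) ^ 2 := by
  have h := lintegral_convolution_sq_le hg hf
  rw [mul_comm]
  convert h using 4 with x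
  rw [← lintegral_sub_left_eq_self _ x]
  simp [mul_comm]

/-- The square of the function is `(1 + ξ²)^{-s}`, integrable on the line because `2s > 1`. This is
where the threshold `s > 1/2` comes from. -/
theorem memLp_weight_neg {s : ℝ} (hs : 1 / 2 < s) :
    MemLp (fun ξ => (weight (-s) ξ : ℂ)) 2 (volume : Measure ℝ) := by
  have hc : Continuous fun ξ => (weight (-s) ξ : ℂ) :=
    Complex.continuous_ofReal.comp (continuous_weight _)
  rw [← integrable_norm_rpow_iff hc.aestronglyMeasurable (by norm_num) (by norm_num)]
  have h : (Module.finrank ℝ ℝ : ℝ) < 2 * s := by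
    rw [Module.finrank_self]; push_cast; linarith
  refine (integrable_rpow_neg_one_add_norm_sq (E := ℝ) h).congr
    (Filter.Eventually.of_forall fun ξ => ?_)
  simp only [Complex.norm_real, Real.norm_of_nonneg (weight_pos (-s) ξ).le]
  rw [weight, ← Real.rpow_mul (by positivity)]
  congr 1
  simp only [ENNReal.toReal_ofNat]
  ring

/-- The norm of the inclusion of `H^s` in the functions with integrable Fourier transform. -/
def fourierBound (s : ℝ) : ℝ≥0∞ := eLpNorm (fun ξ => (weight (-s) ξ : ℂ)) 2 (volume : Measure ℝ)

/-- Hölder's inequality after inserting `1 = weight (-s) · weight s`. -/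
theorem Hs.lintegral_fourier_le {s : ℝ} (u : Hs s) :
    ∫⁻ ξ, ‖(𝓕 u.toL2 : L2) ξ‖ₑ ≤ fourierBound s * ENNReal.ofReal ‖u‖ := by
  rw [u.enorm_eq, ← eLpNorm_one_eq_lintegral_enorm]
  have hc : Continuous fun ξ => (weight (-s) ξ : ℂ) :=
    Complex.continuous_ofReal.comp (continuous_weight _)
  refine le_trans (le_of_eq (eLpNorm_congr_ae ?_)) (eLpNorm_smul_le_mul_eLpNorm
    (p := 2) (q := 2) (r := 1) u.memLp_weight_mul_fourier.1 hc.aestronglyMeasurable)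
  refine Filter.Eventually.of_forall fun ξ => ?_
  simp only [Pi.smul_apply', smul_eq_mul]
  rw [← mul_assoc, ← Complex.ofReal_mul, weight_neg_mul]
  simp

theorem Hs.integrable_fourier {s : ℝ} (hs : 1 / 2 < s) (u : Hs s) :
    Integrable (𝓕 u.toL2 : L2) := by
  refine ⟨Lp.aestronglyMeasurable _, ?_⟩
  exact u.lintegral_fourier_le.trans_lt
    (ENNReal.mul_lt_top (memLp_weight_neg hs).2 ENNReal.ofReal_lt_top)

theorem Hs.coeFn_eq_fourierInv {s : ℝ} (hs : 1 / 2 < s) (u : Hs s) :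
    u.toL2 =ᵐ[volume] 𝓕⁻ ((𝓕 u.toL2 : L2) : ℝ → ℂ) := by
  have h := coeFn_fourierInv_of_integrable (u.integrable_fourier hs)
  rwa [FourierTransform.fourierInv_fourier_eq] at h

-- The product has Fourier transform `F ⋆ G`. The weight at `ξ` is at most `2^s` times the sum of
-- the weights at `t` and `ξ - t`, so it falls on one factor at a time; Young's inequality bounds
-- each term by an `L²` norm times an `L¹` norm.
open scoped Convolution in
theorem Hs.exists_mul {s : ℝ} (hs : 1 / 2 < s) (u v : Hs s) :
    ∃ p : Hs s, p.toL2 =ᵐ[volume] (fun x => u.toL2 x * v.toL2 x) ∧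
      ‖p‖ ≤ 2 * 2 ^ s * (fourierBound s).toReal * ‖u‖ * ‖v‖ := by
  have hs0 : 0 ≤ s := by linarith
  set F : ℝ → ℂ := ((𝓕 u.toL2 : L2) : ℝ → ℂ) with hF
  set G : ℝ → ℂ := ((𝓕 v.toL2 : L2) : ℝ → ℂ) with hG
  have hFi : Integrable F := u.integrable_fourier hs
  have hGi : Integrable G := v.integrable_fourier hs
  set H : ℝ → ℂ := F ⋆[ContinuousLinearMap.mul ℂ ℂ] G with hH
  have hHi : Integrable H := hFi.integrable_convolution (ContinuousLinearMap.mul ℂ ℂ) hGi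
  set wF : ℝ → ℝ≥0∞ := fun ξ => ‖(weight s ξ : ℂ) * F ξ‖ₑ with hwF
  set wG : ℝ → ℝ≥0∞ := fun ξ => ‖(weight s ξ : ℂ) * G ξ‖ₑ with hwG
  have mwF : AEMeasurable wF := u.memLp_weight_mul_fourier.1.enorm
  have mwG : AEMeasurable wG := v.memLp_weight_mul_fourier.1.enorm
  have mF : AEMeasurable (fun ξ => ‖F ξ‖ₑ) := hFi.aestronglyMeasurable.enorm
  have mG : AEMeasurable (fun ξ => ‖G ξ‖ₑ) := hGi.aestronglyMeasurable.enorm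
  set A : ℝ → ℝ≥0∞ := fun ξ => ∫⁻ t, wF t * ‖G (ξ - t)‖ₑ with hA
  set B : ℝ → ℝ≥0∞ := fun ξ => ∫⁻ t, ‖F t‖ₑ * wG (ξ - t) with hB
  set c : ℝ≥0∞ := ENNReal.ofReal (2 ^ s) with hc
  set K := fourierBound s with hK
  have hKtop : K ≠ ⊤ := (memLp_weight_neg hs).2.ne
  have hwe : ∀ ξ (z : ℂ), ‖(weight s ξ : ℂ) * z‖ₑ = ENNReal.ofReal (weight s ξ) * ‖z‖ₑ := by
    intro ξ z
    rw [enorm_mul]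
    congr 1
    rw [← ofReal_norm, Complex.norm_real, Real.norm_of_nonneg (weight_pos s ξ).le]
  have hpt : ∀ ξ, ‖(weight s ξ : ℂ) * H ξ‖ₑ ≤ c * (A ξ + B ξ) := by
    intro ξ
    have hsub : AEMeasurable (fun t => ‖G (ξ - t)‖ₑ) := mG.comp_quasiMeasurePreserving
      (Measure.measurePreserving_sub_left volume ξ).quasiMeasurePreserving
    have h1 : ‖H ξ‖ₑ ≤ ∫⁻ t, ‖F t‖ₑ * ‖G (ξ - t)‖ₑ := by
      rw [hH, convolution_def]
      refine (enorm_integral_le_lintegral_enorm _).trans (le_of_eq ?_)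
      simp
    calc ‖(weight s ξ : ℂ) * H ξ‖ₑ
        ≤ ENNReal.ofReal (weight s ξ) * ∫⁻ t, ‖F t‖ₑ * ‖G (ξ - t)‖ₑ := by
          rw [hwe]; gcongr
      _ = ∫⁻ t, ENNReal.ofReal (weight s ξ) * (‖F t‖ₑ * ‖G (ξ - t)‖ₑ) :=
          (lintegral_const_mul'' _ (mF.mul hsub)).symm
      _ ≤ ∫⁻ t, c * (wF t * ‖G (ξ - t)‖ₑ + ‖F t‖ₑ * wG (ξ - t)) := by
          refine lintegral_mono fun t => ?_
          have h2 : ENNReal.ofReal (weight s ξ) ≤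
              c * (ENNReal.ofReal (weight s t) + ENNReal.ofReal (weight s (ξ - t))) := by
            rw [hc, ← ENNReal.ofReal_add (weight_pos _ _).le (weight_pos _ _).le,
              ← ENNReal.ofReal_mul (by positivity)]
            refine ENNReal.ofReal_le_ofReal ?_
            have := weight_add_le hs0 t (ξ - t)
            rwa [add_sub_cancel] at this
          simp only [hwF, hwG, hwe]
          calc _ ≤ c * (ENNReal.ofReal (weight s t) + ENNReal.ofReal (weight s (ξ - t))) *
                (‖F t‖ₑ * ‖G (ξ - t)‖ₑ) := by gcongr
            _ = _ := by ring
      _ = c * (A ξ + B ξ) := by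
          have hm : AEMeasurable (fun t => wF t * ‖G (ξ - t)‖ₑ) := mwF.mul hsub
          rw [lintegral_const_mul' _ _ ENNReal.ofReal_ne_top,
            lintegral_add_left' hm]
  have hA2 : ∫⁻ ξ, A ξ ^ 2 ≤ (K * ENNReal.ofReal ‖u‖ * ENNReal.ofReal ‖v‖) ^ 2 := by
    refine (lintegral_convolution_sq_le' mwF mG).trans ?_
    rw [hwF, ← eLpNorm_two_sq, ← u.enorm_eq, ← mul_pow]
    refine pow_le_pow_left' ?_ 2
    calc _ ≤ ENNReal.ofReal ‖u‖ * (K * ENNReal.ofReal ‖v‖) := by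
          gcongr; exact v.lintegral_fourier_le
      _ = _ := by ring
  have hB2 : ∫⁻ ξ, B ξ ^ 2 ≤ (K * ENNReal.ofReal ‖u‖ * ENNReal.ofReal ‖v‖) ^ 2 := by
    refine (lintegral_convolution_sq_le mF mwG).trans ?_
    rw [hwG, ← eLpNorm_two_sq, ← v.enorm_eq, ← mul_pow]
    refine pow_le_pow_left' ?_ 2
    gcongr; exact u.lintegral_fourier_le
  have mA : AEMeasurable A :=
    AEMeasurable.lintegral_prod_right' (f := fun p : ℝ × ℝ => wF p.2 * ‖G (p.1 - p.2)‖ₑ)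
      ((mwF.comp_quasiMeasurePreserving Measure.quasiMeasurePreserving_snd).mul
        (mG.comp_quasiMeasurePreserving (quasiMeasurePreserving_sub volume volume)))
  -- With `M` the common bound in `hA2` and `hB2`, `(A + B)² ≤ 2(A² + B²)` gives `4 c² M² = (2 c
  -- M)²`.
  have hL2 : eLpNorm (fun ξ => (weight s ξ : ℂ) * H ξ) 2 (volume : Measure ℝ) ≤
      2 * c * (K * ENNReal.ofReal ‖u‖ * ENNReal.ofReal ‖v‖) := by
    rw [← ENNReal.pow_le_pow_left_iff (n := 2) (by norm_num), eLpNorm_two_sq]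
    calc ∫⁻ ξ, ‖(weight s ξ : ℂ) * H ξ‖ₑ ^ 2 ≤ ∫⁻ ξ, 2 * c ^ 2 * (A ξ ^ 2 + B ξ ^ 2) := by
          refine lintegral_mono fun ξ => ?_
          calc _ ≤ (c * (A ξ + B ξ)) ^ 2 := pow_le_pow_left' (hpt ξ) 2
            _ = c ^ 2 * (A ξ + B ξ) ^ 2 := by ring
            _ ≤ c ^ 2 * (2 ^ (2 - 1) * (A ξ ^ 2 + B ξ ^ 2)) := by
              gcongr
              have := ENNReal.rpow_add_le_mul_rpow_add_rpow (A ξ) (B ξ) (p := 2) (by norm_num)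
              norm_num at this
              simpa using this
            _ = _ := by ring
      _ = 2 * c ^ 2 * ((∫⁻ ξ, A ξ ^ 2) + ∫⁻ ξ, B ξ ^ 2) := by
          rw [lintegral_const_mul' _ _ (by finiteness), lintegral_add_left' (mA.pow_const 2)]
      _ ≤ 2 * c ^ 2 * ((K * ENNReal.ofReal ‖u‖ * ENNReal.ofReal ‖v‖) ^ 2 +
            (K * ENNReal.ofReal ‖u‖ * ENNReal.ofReal ‖v‖) ^ 2) := by gcongr
      _ = _ := by ring
  have hm : MemLp (fun ξ => (weight s ξ : ℂ) * H ξ) 2 (volume : Measure ℝ) :=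
    ⟨(Complex.continuous_ofReal.comp (continuous_weight s)).aestronglyMeasurable.mul
      hHi.aestronglyMeasurable, hL2.trans_lt (by finiteness)⟩
  obtain ⟨p, hp1, hp2⟩ := Hs.exists_of_integrable hs0 hHi hm
  refine ⟨p, ?_, ?_⟩
  · filter_upwards [hp1, u.coeFn_eq_fourierInv hs, v.coeFn_eq_fourierInv hs] with x h1 h2 h3
    rw [h1, h2, h3, Real.fourierInv_eq_fourier_neg, Real.fourierInv_eq_fourier_neg,
      Real.fourierInv_eq_fourier_neg, hH, Real.fourier_mul_convolution_eq hFi hGi]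
  · have h1 : ENNReal.ofReal ‖p‖ ≤ 2 * c * (K * ENNReal.ofReal ‖u‖ * ENNReal.ofReal ‖v‖) := by
      rw [p.enorm_eq]
      refine le_trans (le_of_eq (eLpNorm_congr_ae ?_)) hL2
      filter_upwards [hp2] with ξ hξ
      rw [hξ]
    have h2 := ENNReal.toReal_mono (by finiteness) h1
    rw [ENNReal.toReal_ofReal (norm_nonneg _)] at h2
    refine h2.trans (le_of_eq ?_)
    simp only [ENNReal.toReal_mul, hc, ENNReal.toReal_ofReal (norm_nonneg _),
      ENNReal.toReal_ofReal (show (0 : ℝ) ≤ 2 ^ s by positivity), ENNReal.toReal_ofNat]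
    ring

/-- Conjugation turns the Fourier transform `F(ξ)` into the conjugate of `F(-ξ)`, and the weight is
even. -/
theorem Hs.exists_conj {s : ℝ} (hs : 1 / 2 < s) (u : Hs s) :
    ∃ p : Hs s, p.toL2 =ᵐ[volume] (fun x => (starRingEnd ℂ) (u.toL2 x)) ∧ ‖p‖ ≤ ‖u‖ := by
  have hs0 : 0 ≤ s := by linarith
  set F : ℝ → ℂ := ((𝓕 u.toL2 : L2) : ℝ → ℂ) with hF
  have hFi : Integrable F := u.integrable_fourier hs
  have hneg : MeasurePreserving (fun ξ : ℝ => -ξ) volume volume := Measure.measurePreserving_neg _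
  set G : ℝ → ℂ := fun ξ => (starRingEnd ℂ) (F (-ξ)) with hG
  have hGi : Integrable G :=
    (Complex.conjCLE.toContinuousLinearMap).integrable_comp hFi.comp_neg
  have hn : eLpNorm (fun ξ => (weight s ξ : ℂ) * G ξ) 2 (volume : Measure ℝ) =
      eLpNorm (fun ξ => (weight s ξ : ℂ) * F ξ) 2 (volume : Measure ℝ) := by
    rw [← eLpNorm_comp_measurePreserving u.memLp_weight_mul_fourier.1 hneg]
    refine eLpNorm_congr_norm_ae (Filter.Eventually.of_forall fun ξ => ?_)
    simp [hG, weight_neg_arg, hF]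
  have hm : MemLp (fun ξ => (weight s ξ : ℂ) * G ξ) 2 (volume : Measure ℝ) :=
    ⟨(Complex.continuous_ofReal.comp (continuous_weight s)).aestronglyMeasurable.mul
      hGi.aestronglyMeasurable, hn ▸ u.memLp_weight_mul_fourier.2⟩
  obtain ⟨p, hp1, hp2⟩ := Hs.exists_of_integrable hs0 hGi hm
  refine ⟨p, ?_, ?_⟩
  · filter_upwards [hp1, u.coeFn_eq_fourierInv hs] with x h1 h2
    rw [h1, h2, Real.fourierInv_eq', Real.fourierInv_eq', ← integral_conj, ← integral_neg_eq_self]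
    congr 1; ext ξ
    simp [hG, ← Complex.exp_conj, hF, Complex.conj_ofNat]
  · have h1 : ENNReal.ofReal ‖p‖ = ENNReal.ofReal ‖u‖ := by
      rw [p.enorm_eq, u.enorm_eq, ← hF, ← hn]
      refine eLpNorm_congr_ae ?_
      filter_upwards [hp2] with ξ hξ
      rw [hξ]
    exact ((ENNReal.ofReal_eq_ofReal_iff (norm_nonneg _) (norm_nonneg _)).mp h1).le

/-! ### Limits and derivatives in `L²` are computed pointwise -/

open Filter Topology in
theorem coeFn_ae_eq_of_tendsto {f : ℕ → L2} {g : L2} {F : ℕ → ℝ → ℂ} {G : ℝ → ℂ}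
    (h : Tendsto f atTop (𝓝 g)) (hF : ∀ n, f n =ᵐ[volume] F n)
    (hG : ∀ᵐ x, Tendsto (fun n => F n x) atTop (𝓝 (G x))) : g =ᵐ[volume] G := by
  obtain ⟨ns, hns, hlim⟩ := (tendstoInMeasure_of_tendsto_Lp h).exists_seq_tendsto_ae
  filter_upwards [hlim, hG, ae_all_iff.mpr hF] with x h1 h2 h3
  refine tendsto_nhds_unique h1 ?_
  simp only [h3]
  exact h2.comp hns.tendsto_atTop

-- The difference quotients are taken along the sequence `t + 1/(n+1)`, so that only countably many
-- exceptional null sets occur.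
open Filter Topology in
theorem coeFn_ae_eq_of_hasDerivAt {c : ℝ → L2} {d : L2} {t : ℝ} {F : ℝ → ℝ → ℂ} {F' : ℝ → ℂ}
    (h : HasDerivAt c d t) (hF : ∀ r, c r =ᵐ[volume] fun x => F x r)
    (hF' : ∀ᵐ x, HasDerivAt (F x) (F' x) t) : d =ᵐ[volume] F' := by
  have hseq : Tendsto (fun n : ℕ => t + 1 / ((n : ℝ) + 1)) atTop (𝓝[≠] t) := by
    rw [tendsto_nhdsWithin_iff]
    constructor
    · simpa using tendsto_const_nhds.add (tendsto_one_div_add_atTop_nhds_zero_nat (𝕜 := ℝ))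
    · filter_upwards with n
      have : (0 : ℝ) < 1 / ((n : ℝ) + 1) := by positivity
      simp only [Set.mem_compl_iff, Set.mem_singleton_iff]
      linarith
  have h1 := (hasDerivAt_iff_tendsto_slope.mp h).comp hseq
  refine coeFn_ae_eq_of_tendsto h1
    (F := fun n x => slope (F x) t (t + 1 / ((n : ℝ) + 1))) (fun n => ?_) ?_
  · simp only [Function.comp_apply, slope_def_module]
    filter_upwards [Lp.coeFn_smul ((t + 1 / ((n : ℝ) + 1) - t)⁻¹) (c (t + 1 / ((n : ℝ) + 1)) - c t),
      Lp.coeFn_sub (c (t + 1 / ((n : ℝ) + 1))) (c t), hF t, hF (t + 1 / ((n : ℝ) + 1))]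
      with x h2 h3 h4 h5
    rw [h2, Pi.smul_apply, h3, Pi.sub_apply, h4, h5]
  · filter_upwards [hF'] with x hx
    exact (hasDerivAt_iff_tendsto_slope.mp hx).comp hseq

/-! ### Multiplication and conjugation in `H^s` -/

theorem Hs.ext_ae {s : ℝ} {u v : Hs s} (h : u.toL2 =ᵐ[volume] v.toL2) : u = v :=
  Hs.toL2_injective (Lp.ext h)

theorem Hs.coeFn_add {s : ℝ} (u v : Hs s) :
    (u + v).toL2 =ᵐ[volume] fun x => u.toL2 x + v.toL2 x := by
  rw [map_add]; exact Lp.coeFn_add _ _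

theorem Hs.coeFn_smul {s : ℝ} (c : ℂ) (u : Hs s) :
    (c • u).toL2 =ᵐ[volume] fun x => c * u.toL2 x := by
  rw [map_smul]; exact Lp.coeFn_smul _ _

theorem Hs.toL2_real_smul {s : ℝ} (c : ℝ) (u : Hs s) : (c • u).toL2 = c • u.toL2 :=
  map_smul (Hs.toL2.restrictScalars ℝ) c u

theorem Hs.coeFn_real_smul {s : ℝ} (c : ℝ) (u : Hs s) :
    (c • u).toL2 =ᵐ[volume] fun x => (c : ℂ) * u.toL2 x := by
  rw [Hs.toL2_real_smul]
  filter_upwards [Lp.coeFn_smul c u.toL2] with x hx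
  rw [hx, Pi.smul_apply, Complex.real_smul]

section Algebra

variable {s : ℝ} (hs : 1 / 2 < s)

/-- The pointwise product of two functions of `H^s`. -/
def Hs.mulFun (u v : Hs s) : Hs s := (Hs.exists_mul hs u v).choose

theorem Hs.coeFn_mulFun (u v : Hs s) :
    (Hs.mulFun hs u v).toL2 =ᵐ[volume] fun x => u.toL2 x * v.toL2 x :=
  (Hs.exists_mul hs u v).choose_spec.1

/-- The pointwise product as a continuous bilinear map on `H^s`. -/
def Hs.mul : Hs s →L[ℂ] Hs s →L[ℂ] Hs s :=
  LinearMap.mkContinuous₂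
    (LinearMap.mk₂ ℂ (Hs.mulFun hs)
      (fun u₁ u₂ v => Hs.ext_ae (by
        filter_upwards [Hs.coeFn_mulFun hs (u₁ + u₂) v, Hs.coeFn_add u₁ u₂,
          Hs.coeFn_add (Hs.mulFun hs u₁ v) (Hs.mulFun hs u₂ v), Hs.coeFn_mulFun hs u₁ v,
          Hs.coeFn_mulFun hs u₂ v] with x h1 h2 h3 h4 h5
        rw [h1, h2, h3, h4, h5, add_mul]))
      (fun c u v => Hs.ext_ae (by
        filter_upwards [Hs.coeFn_mulFun hs (c • u) v, Hs.coeFn_smul c u,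
          Hs.coeFn_smul c (Hs.mulFun hs u v), Hs.coeFn_mulFun hs u v] with x h1 h2 h3 h4
        rw [h1, h2, h3, h4, mul_assoc]))
      (fun u v₁ v₂ => Hs.ext_ae (by
        filter_upwards [Hs.coeFn_mulFun hs u (v₁ + v₂), Hs.coeFn_add v₁ v₂,
          Hs.coeFn_add (Hs.mulFun hs u v₁) (Hs.mulFun hs u v₂), Hs.coeFn_mulFun hs u v₁,
          Hs.coeFn_mulFun hs u v₂] with x h1 h2 h3 h4 h5
        rw [h1, h2, h3, h4, h5, mul_add]))
      (fun c u v => Hs.ext_ae (by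
        filter_upwards [Hs.coeFn_mulFun hs u (c • v), Hs.coeFn_smul c v,
          Hs.coeFn_smul c (Hs.mulFun hs u v), Hs.coeFn_mulFun hs u v] with x h1 h2 h3 h4
        rw [h1, h2, h3, h4, mul_left_comm])))
    (2 * 2 ^ s * (fourierBound s).toReal)
    (fun u v => (Hs.exists_mul hs u v).choose_spec.2)

theorem Hs.coeFn_mul (u v : Hs s) :
    (Hs.mul hs u v).toL2 =ᵐ[volume] fun x => u.toL2 x * v.toL2 x :=
  Hs.coeFn_mulFun hs u v

/-- Pointwise complex conjugation on `H^s`. -/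
def Hs.conjFun (u : Hs s) : Hs s := (Hs.exists_conj hs u).choose

theorem Hs.coeFn_conjFun (u : Hs s) :
    (Hs.conjFun hs u).toL2 =ᵐ[volume] fun x => (starRingEnd ℂ) (u.toL2 x) :=
  (Hs.exists_conj hs u).choose_spec.1

/-- Pointwise complex conjugation as a continuous real linear map on `H^s`. -/
def Hs.conj : Hs s →L[ℝ] Hs s :=
  LinearMap.mkContinuous
    { toFun := Hs.conjFun hs
      map_add' := fun u v => Hs.ext_ae (by
        filter_upwards [Hs.coeFn_conjFun hs (u + v), Hs.coeFn_add u v,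
          Hs.coeFn_add (Hs.conjFun hs u) (Hs.conjFun hs v), Hs.coeFn_conjFun hs u,
          Hs.coeFn_conjFun hs v] with x h1 h2 h3 h4 h5
        rw [h1, h2, h3, h4, h5, map_add])
      map_smul' := fun c u => Hs.ext_ae (by
        filter_upwards [Hs.coeFn_conjFun hs (c • u), Hs.coeFn_real_smul c u,
          Hs.coeFn_real_smul c (Hs.conjFun hs u), Hs.coeFn_conjFun hs u] with x h1 h2 h3 h4
        rw [h1, h2, RingHom.id_apply, h3, h4, map_mul, Complex.conj_ofReal]) }
    1 (fun u => by rw [one_mul]; exact (Hs.exists_conj hs u).choose_spec.2)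

theorem Hs.coeFn_conj (u : Hs s) :
    (Hs.conj hs u).toL2 =ᵐ[volume] fun x => (starRingEnd ℂ) (u.toL2 x) :=
  Hs.coeFn_conjFun hs u

end Algebra

/-! ### Multiplication operators on `H^s` -/

/-- The operator `A` on `H^s` is the multiplication by the function `a`. -/
def IsMultiplicationBy {s : ℝ} (A : Hs s →L[ℂ] Hs s) (a : ℝ → ℂ) : Prop :=
  ∀ v, (A v).toL2 =ᵐ[volume] fun x => a x * v.toL2 x

namespace IsMultiplicationBy

variable {s : ℝ} {A B : Hs s →L[ℂ] Hs s} {a b : ℝ → ℂ}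

theorem one : IsMultiplicationBy (1 : Hs s →L[ℂ] Hs s) fun _ => 1 := fun v => by
  simp only [one_apply_eq_self, one_mul]; rfl

theorem mul (hA : IsMultiplicationBy A a) (hB : IsMultiplicationBy B b) :
    IsMultiplicationBy (A * B) fun x => a x * b x := fun v => by
  filter_upwards [hA (B v), hB v] with x h1 h2
  rw [mul_apply_eq_comp, h1, h2, mul_assoc]

theorem pow (hA : IsMultiplicationBy A a) (n : ℕ) :
    IsMultiplicationBy (A ^ n) fun x => a x ^ n := by
  induction n with
  | zero => simpa only [pow_zero] using one
  | succ n ih => simpa only [pow_succ] using ih.mul hA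

theorem smul (hA : IsMultiplicationBy A a) (c : ℂ) :
    IsMultiplicationBy (c • A) fun x => c * a x := fun v => by
  filter_upwards [hA v, Hs.coeFn_smul c (A v)] with x h1 h2
  rw [_root_.smul_apply, h2, h1, mul_assoc]

theorem sum {ι : Type*} {S : Finset ι} {A : ι → Hs s →L[ℂ] Hs s} {a : ι → ℝ → ℂ}
    (h : ∀ i, IsMultiplicationBy (A i) (a i)) :
    IsMultiplicationBy (∑ i ∈ S, A i) fun x => ∑ i ∈ S, a i x := by
  classical
  induction S using Finset.induction_on with
  | empty =>
    intro v
    simp only [Finset.sum_empty, zero_apply, map_zero, zero_mul]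
    exact Lp.coeFn_zero _ _ _
  | insert i S hi ih =>
    intro v
    filter_upwards [h i v, ih v, Hs.coeFn_add (A i v) ((∑ i ∈ S, A i) v)] with x h1 h2 h3
    rw [Finset.sum_insert hi, Finset.sum_insert hi, add_apply, h3, h1, h2,
      add_mul]

/-- The partial sums of the exponential series applied to `v` converge in `H^s`, hence in `L²`,
while pointwise they converge to `exp(a(x)) v(x)`. -/
theorem exp (hs : 0 ≤ s) (hA : IsMultiplicationBy A a) :
    IsMultiplicationBy (NormedSpace.exp A) fun x => Complex.exp (a x) := by
  intro v
  have := Hs.completeSpace hs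
  have h1 := (NormedSpace.exp_series_hasSum_exp' (𝕂 := ℂ) A).tendsto_sum_nat
  have h2 : Filter.Tendsto (fun n : ℕ =>
      Hs.toL2CLM hs ((∑ i ∈ Finset.range n, ((i.factorial : ℂ)⁻¹) • A ^ i) v)) Filter.atTop
      (nhds (Hs.toL2CLM hs (NormedSpace.exp A v))) :=
    (((Hs.toL2CLM hs).continuous.comp
      (ContinuousLinearMap.apply ℂ (Hs s) v).continuous).tendsto _).comp h1
  refine coeFn_ae_eq_of_tendsto h2
    (fun n => IsMultiplicationBy.sum (fun i => (hA.pow i).smul _) v) ?_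
  filter_upwards with x
  refine Filter.Tendsto.mul_const _ ?_
  have h3 := (NormedSpace.exp_series_hasSum_exp' (𝕂 := ℂ) (a x)).tendsto_sum_nat
  rw [← Complex.exp_eq_exp_ℂ] at h3
  simpa only [smul_eq_mul] using h3

end IsMultiplicationBy

/-! ### The nonlinear substep -/

section Nonlinear

variable {s : ℝ} (hs : 1 / 2 < s) (σ : ℕ)

/-- The multiplication by `|u|^{2σ}` as an operator on `H^s`. -/
def modPow (u : Hs s) : Hs s →L[ℂ] Hs s := Hs.mul hs (Hs.mul hs u (Hs.conj hs u)) ^ σ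

theorem isMultiplicationBy_modPow (u : Hs s) :
    IsMultiplicationBy (modPow hs σ u) fun x => ((‖u.toL2 x‖ ^ (2 * σ) : ℝ) : ℂ) := by
  intro v
  have h1 : IsMultiplicationBy (Hs.mul hs (Hs.mul hs u (Hs.conj hs u)))
      (Hs.mul hs u (Hs.conj hs u)).toL2 := fun w => Hs.coeFn_mul hs _ w
  filter_upwards [h1.pow σ v, Hs.coeFn_mul hs u (Hs.conj hs u), Hs.coeFn_conj hs u]
    with x h2 h3 h4
  rw [modPow, h2, h3, h4, Complex.mul_conj, Complex.normSq_eq_norm_sq, ← Complex.ofReal_pow,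
    pow_mul]

/-- The nonlinear substep on `H^s`. -/
def nlHs (τ : ℝ) (u : Hs s) : Hs s :=
  NormedSpace.exp (τ • (Complex.I • modPow hs σ u)) u

theorem isMultiplicationBy_exp_modPow (τ : ℝ) (u : Hs s) :
    IsMultiplicationBy (NormedSpace.exp (τ • (Complex.I • modPow hs σ u)))
      fun x => Complex.exp (Complex.I * ((τ * ‖u.toL2 x‖ ^ (2 * σ) : ℝ) : ℂ)) := by
  have h := (((isMultiplicationBy_modPow hs σ u).smul Complex.I).smul (τ : ℂ)).exp
    (by linarith : 0 ≤ s)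
  intro v
  have e : (τ : ℂ) • (Complex.I • modPow hs σ u) = τ • (Complex.I • modPow hs σ u) := rfl
  rw [e] at h
  filter_upwards [h v] with x hx
  rw [hx]
  congr 2
  push_cast
  ring

theorem coeFn_nlStep (τ : ℝ) (f : L2) :
    nlStep σ τ f =ᵐ[volume]
      fun x => Complex.exp (Complex.I * ((τ * ‖f x‖ ^ (2 * σ) : ℝ) : ℂ)) * f x :=
  (memLp_phase _ (aemeasurable_nlPhase σ τ f) f).coeFn_toLp

theorem toL2_nlHs (τ : ℝ) (u : Hs s) : (nlHs hs σ τ u).toL2 = nlStep σ τ u.toL2 :=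
  Lp.ext ((isMultiplicationBy_exp_modPow hs σ τ u u).trans (coeFn_nlStep σ τ u.toL2).symm)

theorem differentiable_clm_apply_real {A : Hs s → Hs s →L[ℂ] Hs s} {f : Hs s → Hs s}
    (hA : Differentiable ℝ A) (hf : Differentiable ℝ f) :
    Differentiable ℝ fun u => A u (f u) := by
  have h : Differentiable ℝ fun p : (Hs s →L[ℂ] Hs s) × Hs s => p.1 p.2 := fun p =>
    (isBoundedBilinearMap_apply.differentiableAt p).restrictScalars ℝ
  exact h.comp (hA.prodMk hf)

/-- Differentiability is over the reals because conjugation is not complex linear. -/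
theorem differentiable_modPow : Differentiable ℝ (modPow hs σ) := by
  have hm : Differentiable ℝ (Hs.mul hs) := fun u =>
    ((Hs.mul hs).differentiableAt (x := u)).restrictScalars ℝ
  have h1 : Differentiable ℝ fun u => Hs.mul hs u (Hs.conj hs u) :=
    differentiable_clm_apply_real hm (Hs.conj hs).differentiable
  have h2 : Differentiable ℝ fun u => Hs.mul hs (Hs.mul hs u (Hs.conj hs u)) := hm.comp h1
  unfold modPow
  exact h2.fun_pow σ

theorem differentiable_nlHs (τ : ℝ) : Differentiable ℝ (nlHs hs σ τ) := by
  have := Hs.completeSpace (by linarith : 0 ≤ s)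
  refine differentiable_clm_apply_real ?_ differentiable_id
  have he : Differentiable ℝ (NormedSpace.exp : (Hs s →L[ℂ] Hs s) → _) := fun A =>
    (NormedSpace.exp_analytic (𝕂 := ℂ) A).differentiableAt.restrictScalars ℝ
  exact he.comp (((differentiable_modPow hs σ).const_smul Complex.I).const_smul τ)

/-- The derivative of `|z|^{2σ}` in the direction `k`. -/
def modPowDeriv (z k : ℂ) : ℝ :=
  σ * Complex.normSq z ^ (σ - 1) * (2 * (z.re * k.re + z.im * k.im))

theorem hasDerivAt_norm_pow_line (z k : ℂ) :
    HasDerivAt (fun t : ℝ => ‖z + t * k‖ ^ (2 * σ)) (modPowDeriv σ z k) 0 := by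
  have e : (fun t : ℝ => ‖z + t * k‖ ^ (2 * σ)) =
      fun t : ℝ => ((z.re + t * k.re) * (z.re + t * k.re) +
        (z.im + t * k.im) * (z.im + t * k.im)) ^ σ := by
    ext t
    rw [pow_mul, ← Complex.normSq_eq_norm_sq, Complex.normSq_apply]
    simp
  rw [e]
  have h1 : HasDerivAt (fun t : ℝ => z.re + t * k.re) k.re 0 := by
    simpa using ((hasDerivAt_id (0 : ℝ)).mul_const k.re).const_add z.re
  have h2 : HasDerivAt (fun t : ℝ => z.im + t * k.im) k.im 0 := by
    simpa using ((hasDerivAt_id (0 : ℝ)).mul_const k.im).const_add z.im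
  refine (((h1.fun_mul h1).fun_add (h2.fun_mul h2)).fun_pow σ).congr_deriv ?_
  simp only [zero_mul, add_zero, modPowDeriv, Complex.normSq_apply]
  ring

theorem hasDerivAt_line (z k : ℂ) : HasDerivAt (fun t : ℝ => z + t * k) k 0 := by
  have h := (((hasDerivAt_id (0 : ℝ)).ofReal_comp).mul_const k).const_add z
  simpa using h

/-- The derivative of the nonlinear substep at `z` in the direction `k`, pointwise. -/
def nlDeriv (τ : ℝ) (z k : ℂ) : ℂ :=
  Complex.exp (Complex.I * ((τ * ‖z‖ ^ (2 * σ) : ℝ) : ℂ)) *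
    (k + Complex.I * ((τ * modPowDeriv σ z k : ℝ) : ℂ) * z)

theorem hasDerivAt_nl_line (τ : ℝ) (z k : ℂ) :
    HasDerivAt (fun t : ℝ => Complex.exp (Complex.I * ((τ * ‖z + t * k‖ ^ (2 * σ) : ℝ) : ℂ)) *
      (z + t * k)) (nlDeriv σ τ z k) 0 := by
  have h1 := (((hasDerivAt_norm_pow_line σ z k).const_mul τ).ofReal_comp).const_mul Complex.I
  refine (h1.cexp.fun_mul (hasDerivAt_line z k)).congr_deriv ?_
  simp only [nlDeriv, Complex.ofReal_zero, zero_mul, add_zero]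
  ring

theorem Hs.coeFn_add_real_smul (u h : Hs s) (t : ℝ) :
    (u + t • h).toL2 =ᵐ[volume] fun x => u.toL2 x + t * h.toL2 x := by
  filter_upwards [Hs.coeFn_add u (t • h), Hs.coeFn_real_smul t h] with x h1 h2
  rw [h1, h2]

theorem hasDerivAt_toL2_comp_line {Φ : Hs s → Hs s} {D : Hs s →L[ℝ] Hs s} {u : Hs s}
    (hs0 : 0 ≤ s) (hΦ : HasFDerivAt Φ D u) (h : Hs s) :
    HasDerivAt (fun t : ℝ => (Φ (u + t • h)).toL2) (D h).toL2 0 := by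
  have h1 : HasDerivAt (fun t : ℝ => u + t • h) h 0 := by
    simpa using ((hasDerivAt_id (0 : ℝ)).smul_const h).const_add u
  have h2 : HasFDerivAt Φ D (u + (0 : ℝ) • h) := by simpa using hΦ
  have h3 := h2.comp_hasDerivAt 0 h1
  exact ((Hs.toL2CLM hs0).restrictScalars ℝ).hasFDerivAt.comp_hasDerivAt 0 h3

theorem coeFn_fderiv_nlHs (τ : ℝ) (u h : Hs s) :
    (fderiv ℝ (nlHs hs σ τ) u h).toL2 =ᵐ[volume]
      fun x => nlDeriv σ τ (u.toL2 x) (h.toL2 x) := by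
  have h1 := hasDerivAt_toL2_comp_line (by linarith)
    (differentiable_nlHs hs σ τ u).hasFDerivAt h
  refine coeFn_ae_eq_of_hasDerivAt h1 (F := fun x t =>
    Complex.exp (Complex.I * ((τ * ‖u.toL2 x + t * h.toL2 x‖ ^ (2 * σ) : ℝ) : ℂ)) *
      (u.toL2 x + t * h.toL2 x)) (fun t => ?_) ?_
  · rw [toL2_nlHs]
    filter_upwards [coeFn_nlStep σ τ (u + t • h).toL2, Hs.coeFn_add_real_smul u h t]
      with x h2 h3
    rw [h2, h3]
  · filter_upwards with x
    exact hasDerivAt_nl_line σ τ _ _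

/-- The form is the imaginary part of `conj(a) b`, so the common unit phase cancels. The remaining
map is `k ↦ k + i c Re(conj(z) k) z` with `c` real: its two cross terms cancel, and its quadratic
term is real. -/
theorem nlDeriv_symplectic (τ : ℝ) (z h k : ℂ) :
    (nlDeriv σ τ z h).re * (nlDeriv σ τ z k).im - (nlDeriv σ τ z k).re * (nlDeriv σ τ z h).im =
      h.re * k.im - k.re * h.im := by
  have key : ∀ a b : ℂ, a.re * b.im - b.re * a.im = ((starRingEnd ℂ) a * b).im := by
    intro a b; simp; ring
  set θ : ℝ := τ * ‖z‖ ^ (2 * σ) with hθ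
  have hunit : (starRingEnd ℂ) (Complex.exp (Complex.I * (θ : ℂ))) *
      Complex.exp (Complex.I * (θ : ℂ)) = 1 := by
    rw [← Complex.exp_conj, ← Complex.exp_add]
    simp
  rw [key, nlDeriv, nlDeriv, map_mul, ← hθ]
  have e : ∀ a b c d : ℂ, a * b * (c * d) = (a * c) * (b * d) := fun a b c d => by ring
  rw [e, hunit, one_mul]
  obtain ⟨C, hC⟩ : ∃ C : ℝ, ∀ k, modPowDeriv σ z k = C * (z.re * k.re + z.im * k.im) :=
    ⟨σ * Complex.normSq z ^ (σ - 1) * 2, fun k => by simp only [modPowDeriv]; ring⟩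
  simp only [hC, map_add, map_mul, Complex.conj_I, Complex.conj_ofReal, Complex.mul_im,
    Complex.add_re, Complex.add_im, Complex.mul_re, Complex.neg_re, Complex.neg_im, Complex.I_re,
    Complex.I_im, Complex.ofReal_re, Complex.ofReal_im, Complex.conj_re, Complex.conj_im]
  ring

theorem symplecticForm_fderiv_nlHs (τ : ℝ) (u h k : Hs s) :
    symplecticForm (fderiv ℝ (nlHs hs σ τ) u h).toL2 (fderiv ℝ (nlHs hs σ τ) u k).toL2 =
      symplecticForm h.toL2 k.toL2 := by
  refine integral_congr_ae ?_
  filter_upwards [coeFn_fderiv_nlHs hs σ τ u h, coeFn_fderiv_nlHs hs σ τ u k] with x h1 h2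
  rw [h1, h2, nlDeriv_symplectic]

/-! ### The Hamiltonian `H₂` -/

/-- Writes the energy as a bilinear expression in two differentiable maps, so it can be
differentiated by the product rule for the inner product. -/
theorem integral_norm_pow_eq_inner (u : Hs s) :
    ∫ x, ‖u.toL2 x‖ ^ (2 * σ + 2) = (inner ℂ u.toL2 (modPow hs σ u u).toL2 : ℂ).re := by
  rw [L2.inner_def]
  have hi : Integrable fun x => inner ℂ (u.toL2 x) ((modPow hs σ u u).toL2 x) :=
    L2.integrable_inner _ _
  have := integral_re hi
  simp only [RCLike.re_eq_complex_re] at this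
  rw [← this]
  refine integral_congr_ae ?_
  filter_upwards [isMultiplicationBy_modPow hs σ u u] with x hx
  rw [hx, RCLike.inner_apply, mul_assoc, Complex.mul_conj, ← Complex.ofReal_mul, Complex.ofReal_re,
    Complex.normSq_eq_norm_sq, pow_add]

/-- The derivative of `|z|^{2σ} z` in the direction `k`. -/
theorem hasDerivAt_modPow_line (z k : ℂ) :
    HasDerivAt (fun t : ℝ => ((‖z + t * k‖ ^ (2 * σ) : ℝ) : ℂ) * (z + t * k))
      (((modPowDeriv σ z k : ℝ) : ℂ) * z + ((‖z‖ ^ (2 * σ) : ℝ) : ℂ) * k) 0 := by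
  refine (((hasDerivAt_norm_pow_line σ z k).ofReal_comp).fun_mul
    (hasDerivAt_line z k)).congr_deriv ?_
  simp

theorem differentiable_modPow_apply : Differentiable ℝ fun u : Hs s => modPow hs σ u u :=
  differentiable_clm_apply_real (differentiable_modPow hs σ) differentiable_id

theorem coeFn_fderiv_modPow_apply (u h : Hs s) :
    (fderiv ℝ (fun u : Hs s => modPow hs σ u u) u h).toL2 =ᵐ[volume]
      fun x => ((modPowDeriv σ (u.toL2 x) (h.toL2 x) : ℝ) : ℂ) * u.toL2 x +
        ((‖u.toL2 x‖ ^ (2 * σ) : ℝ) : ℂ) * h.toL2 x := by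
  have h1 := hasDerivAt_toL2_comp_line (by linarith)
    (differentiable_modPow_apply hs σ u).hasFDerivAt h
  refine coeFn_ae_eq_of_hasDerivAt h1 (F := fun x t =>
    ((‖u.toL2 x + t * h.toL2 x‖ ^ (2 * σ) : ℝ) : ℂ) * (u.toL2 x + t * h.toL2 x)) (fun t => ?_) ?_
  · filter_upwards [isMultiplicationBy_modPow hs σ (u + t • h) (u + t • h),
      Hs.coeFn_add_real_smul u h t] with x h2 h3
    rw [h2, h3]
  · filter_upwards with x
    exact hasDerivAt_modPow_line σ _ _

/-- A Schwartz function as an element of `H^s`. -/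
def Hs.ofSchwartz (s : ℝ) (φ : 𝓢(ℝ, ℂ)) : Hs s :=
  ⟨φ.toLp 2 (volume : Measure ℝ), by
    have h : MemSobolev s 2 (φ : 𝓢'(ℝ, ℂ)) := φ.memSobolev
    rw [← Lp.toTemperedDistribution_toLp_eq (p := 2)] at h
    exact h⟩

theorem Hs.toL2_ofSchwartz (φ : 𝓢(ℝ, ℂ)) :
    (Hs.ofSchwartz s φ).toL2 = φ.toLp 2 (volume : Measure ℝ) := rfl

/-- Pointwise the product rule gives `(2σ + 2)|z|^{2σ} Re(conj(z) k)`: a contribution `2σ` from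
differentiating `|z|^{2σ}` and one from each remaining factor. The prefactor of `H₂` cancels it. -/
theorem hasVariationalDerivative_energyH2 (u : Hs s) :
    HasVariationalDerivative (energyH2 σ) u.toL2 (modPow hs σ u u).toL2 := by
  intro φ
  set h : Hs s := Hs.ofSchwartz s φ with hh
  set D := fderiv ℝ (fun u : Hs s => modPow hs σ u u) u h with hD
  have hlin : ∀ ε : ℝ, u.toL2 + ε • φ.toLp 2 (volume : Measure ℝ) = (u + ε • h).toL2 := by
    intro ε
    rw [map_add, Hs.toL2_real_smul]
    rfl
  have h1 : HasDerivAt (fun ε : ℝ => (u + ε • h).toL2) h.toL2 0 :=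
    hasDerivAt_toL2_comp_line (Φ := id) (by linarith) (hasFDerivAt_id u) h
  have h2 : HasDerivAt (fun ε : ℝ => (modPow hs σ (u + ε • h) (u + ε • h)).toL2) D.toL2 0 :=
    hasDerivAt_toL2_comp_line (by linarith) (differentiable_modPow_apply hs σ u).hasFDerivAt h
  have h3 : HasDerivAt (fun ε : ℝ => (inner ℂ (u + ε • h).toL2
      (modPow hs σ (u + ε • h) (u + ε • h)).toL2 : ℂ).re)
      (inner ℂ u.toL2 D.toL2 + inner ℂ h.toL2 (modPow hs σ u u).toL2 : ℂ).re 0 := by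
    have := Complex.reCLM.hasFDerivAt.comp_hasDerivAt (0 : ℝ) (h1.inner ℂ h2)
    rw [zero_smul, add_zero] at this
    exact this
  have h4 := h3.const_mul (1 / (2 * (σ : ℝ) + 2))
  have e : (fun ε : ℝ => energyH2 σ (u.toL2 + ε • φ.toLp 2 (volume : Measure ℝ))) =
      fun ε : ℝ => 1 / (2 * (σ : ℝ) + 2) * (inner ℂ (u + ε • h).toL2
      (modPow hs σ (u + ε • h) (u + ε • h)).toL2 : ℂ).re := by
    ext ε
    rw [hlin, energyH2, integral_norm_pow_eq_inner hs]
  rw [e]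
  refine h4.congr_deriv ?_
  symm
  rw [L2.inner_def, L2.inner_def, ← integral_add (L2.integrable_inner _ _)
    (L2.integrable_inner _ _)]
  have hi : Integrable fun x => inner ℂ (u.toL2 x) (D.toL2 x) +
      inner ℂ (h.toL2 x) ((modPow hs σ u u).toL2 x) :=
    (L2.integrable_inner _ _).add (L2.integrable_inner _ _)
  have hre := integral_re hi
  simp only [RCLike.re_eq_complex_re] at hre
  rw [← hre, ← integral_const_mul]
  refine integral_congr_ae ?_
  have hφ : h.toL2 =ᵐ[volume] φ := φ.coeFn_toLp 2 volume
  filter_upwards [hφ, isMultiplicationBy_modPow hs σ u u, coeFn_fderiv_modPow_apply hs σ u h]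
    with x h5 h6 h7
  rw [hD, h7, h6, h5, RCLike.inner_apply, RCLike.inner_apply]
  have hpos : (2 * (σ : ℝ) + 2) ≠ 0 := by positivity
  -- The truncated exponent `σ - 1` is harmless at `σ = 0`, where the factor `σ` vanishes.
  have hσ : ∀ r : ℝ, (σ : ℝ) * r ^ (σ - 1) * r = σ * r ^ σ := by
    intro r
    rcases Nat.eq_zero_or_pos σ with rfl | hp
    · simp
    · rw [mul_assoc, ← pow_succ, Nat.sub_add_cancel hp]
  have hσ' := hσ (Complex.normSq (u.toL2 x))
  rw [pow_mul, ← Complex.normSq_eq_norm_sq]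
  generalize u.toL2 x = z at *
  generalize φ x = k at *
  simp only [modPowDeriv, Complex.add_re, Complex.mul_re, Complex.ofReal_re, Complex.ofReal_im,
    Complex.conj_re, Complex.conj_im, Complex.mul_im, Complex.add_im]
  have hn : Complex.normSq z = z.re * z.re + z.im * z.im := Complex.normSq_apply z
  field_simp
  have : (σ : ℝ) * Complex.normSq z ^ (σ - 1) * (z.re * z.re + z.im * z.im) =
    σ * Complex.normSq z ^ σ := by rw [← hn]; exact hσ'
  linear_combination (-2 * (z.re * k.re + z.im * k.im)) * this

end Nonlinear

/-! ### The exact flow of `H₂`. -/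

theorem exists_nonlinear_flow {s : ℝ} (hs : 1 / 2 < s) (σ : ℕ) (u₀ : Hs s) : ∃ U : ℝ → Hs s,
      U 0 = u₀ ∧ (∀ t, (U t).toL2 = nlStep σ t u₀.toL2) ∧
      ∀ t, ∃ g : Hs s,
        (∀ᵐ x, g.toL2 x = ((‖(U t).toL2 x‖ ^ (2 * σ) : ℝ) : ℂ) * (U t).toL2 x) ∧
        HasVariationalDerivative (energyH2 σ) (U t).toL2 g.toL2 ∧
        HasDerivAt U (Complex.I • g) t := by
  have := Hs.completeSpace (by linarith : 0 ≤ s)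
  refine ⟨fun t => nlHs hs σ t u₀, ?_, fun t => toL2_nlHs hs σ t u₀, fun t => ?_⟩
  · simp [nlHs, NormedSpace.exp_zero]
  set u := nlHs hs σ t u₀ with hu
  refine ⟨modPow hs σ u u, isMultiplicationBy_modPow hs σ u u,
    hasVariationalDerivative_energyH2 hs σ u, ?_⟩
  have h1 := hasDerivAt_exp_smul_const' (𝕂 := ℝ) (Complex.I • modPow hs σ u₀) t
  have h2 := ((ContinuousLinearMap.apply ℂ (Hs s) u₀).restrictScalars
    ℝ).hasFDerivAt.comp_hasDerivAt t h1
  refine h2.congr_deriv ?_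
  -- The exponential has the generator frozen at `u₀`; as the phase leaves the modulus unchanged, it
  -- acts on `u` as the generator at `u` does.
  have hg : modPow hs σ u u = modPow hs σ u₀ u := by
    refine Hs.ext_ae ?_
    filter_upwards [isMultiplicationBy_modPow hs σ u u, isMultiplicationBy_modPow hs σ u₀ u,
      isMultiplicationBy_exp_modPow hs σ t u₀ u₀] with x h3 h4 h5
    rw [h3, h4]
    congr 3
    have : u.toL2 x = (NormedSpace.exp (t • Complex.I • modPow hs σ u₀) u₀).toL2 x := rfl
    rw [this, h5, norm_mul, mul_comm Complex.I, Complex.norm_exp_ofReal_mul_I, one_mul]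
  rw [hg]
  rfl

/-! ### Unitarity of the substeps -/

theorem coeFn_phaseMul (θ : ℝ → ℝ) (hθ : AEMeasurable θ) (f : L2) :
    phaseMul θ hθ f =ᵐ[volume] fun x => Complex.exp (Complex.I * (θ x : ℂ)) * f x :=
  (memLp_phase θ hθ f).coeFn_toLp

theorem norm_exp_I_mul_ofReal (t : ℝ) : ‖Complex.exp (Complex.I * (t : ℂ))‖ = 1 := by
  rw [mul_comm, Complex.norm_exp_ofReal_mul_I]

theorem phaseMul_phaseMul_of_add_eq_zero {θ ζ : ℝ → ℝ} (hθ : AEMeasurable θ) (hζ : AEMeasurable ζ)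
    (h : ∀ x, ζ x + θ x = 0) (f : L2) : phaseMul ζ hζ (phaseMul θ hθ f) = f := by
  refine Lp.ext ?_
  filter_upwards [coeFn_phaseMul ζ hζ (phaseMul θ hθ f), coeFn_phaseMul θ hθ f] with x h1 h2
  rw [h1, h2, ← mul_assoc, ← Complex.exp_add, ← mul_add, ← Complex.ofReal_add, h]
  simp

/-- Multiplication by `exp(i θ)` as a unitary operator on `L²`. -/
def phaseMulₗᵢ (θ : ℝ → ℝ) (hθ : AEMeasurable θ) : L2 ≃ₗᵢ[ℂ] L2 where
  toFun := phaseMul θ hθ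
  invFun := phaseMul (fun x => -θ x) hθ.neg
  map_add' f g := by
    refine Lp.ext ?_
    filter_upwards [coeFn_phaseMul θ hθ (f + g), coeFn_phaseMul θ hθ f, coeFn_phaseMul θ hθ g,
      Lp.coeFn_add f g, Lp.coeFn_add (phaseMul θ hθ f) (phaseMul θ hθ g)] with x h1 h2 h3 h4 h5
    rw [h1, h5, h4, Pi.add_apply, Pi.add_apply, h2, h3, mul_add]
  map_smul' c f := by
    refine Lp.ext ?_
    filter_upwards [coeFn_phaseMul θ hθ (c • f), coeFn_phaseMul θ hθ f,
      Lp.coeFn_smul c f, Lp.coeFn_smul c (phaseMul θ hθ f)] with x h1 h2 h3 h4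
    rw [h1, RingHom.id_apply, h4, h3, Pi.smul_apply, Pi.smul_apply, h2, smul_eq_mul, smul_eq_mul,
      mul_left_comm]
  left_inv := phaseMul_phaseMul_of_add_eq_zero hθ hθ.neg fun x => by simp
  right_inv := phaseMul_phaseMul_of_add_eq_zero hθ.neg hθ fun x => by simp
  norm_map' f := by
    change ‖phaseMul θ hθ f‖ = ‖f‖
    have h : ∀ᵐ x, ‖phaseMul θ hθ f x‖ = ‖f x‖ := by
      filter_upwards [coeFn_phaseMul θ hθ f] with x hx
      rw [hx, norm_mul, norm_exp_I_mul_ofReal, one_mul]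
    exact le_antisymm (Lp.norm_le_norm_of_ae_le (h.mono fun x hx => hx.le))
      (Lp.norm_le_norm_of_ae_le (h.mono fun x hx => hx.ge))

/-- The linear substep as a unitary operator on `L²`. -/
def freeStepₗᵢ (r : ℝ) : L2 ≃ₗᵢ[ℂ] L2 :=
  ((Lp.fourierTransformₗᵢ ℝ ℂ).trans (phaseMulₗᵢ _ (aemeasurable_freePhase r))).trans
    (Lp.fourierTransformₗᵢ ℝ ℂ).symm

theorem fourier_freeStep (r : ℝ) (f : L2) :
    (𝓕 (freeStep r f) : L2) =ᵐ[volume] fun ξ =>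
      Complex.exp (Complex.I * ((-r * (2 * Real.pi * ξ) ^ 2 : ℝ) : ℂ)) * (𝓕 f : L2) ξ := by
  rw [freeStep, FourierTransform.fourier_fourierInv_eq]
  exact coeFn_phaseMul _ _ _

theorem charge_eq_norm_sq (f : L2) : charge f = ‖f‖ ^ 2 := by
  have h := L2.inner_def (𝕜 := ℂ) f f
  rw [inner_self_eq_norm_sq_to_K] at h
  have h2 : ∫ x, inner ℂ (f x) (f x) = ((∫ x, ‖f x‖ ^ 2 : ℝ) : ℂ) := by
    rw [← integral_complex_ofReal]
    refine integral_congr_ae (Filter.Eventually.of_forall fun x => ?_)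
    simp only [inner_self_eq_norm_sq_to_K]
    simp
  rw [h2] at h
  refine Complex.ofReal_injective (h.symm.trans ?_)
  simp

theorem charge_nlStep (σ : ℕ) (τ : ℝ) (f : L2) : charge (nlStep σ τ f) = charge f := by
  rw [charge_eq_norm_sq, charge_eq_norm_sq]
  exact congrArg (· ^ 2) ((phaseMulₗᵢ _ (aemeasurable_nlPhase σ τ f)).norm_map f)

theorem charge_freeStep (r : ℝ) (f : L2) : charge (freeStep r f) = charge f := by
  rw [charge_eq_norm_sq, charge_eq_norm_sq]
  exact congrArg (· ^ 2) ((freeStepₗᵢ r).norm_map f)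

theorem charge_lieScheme_succ (σ : ℕ) (T : ℝ≥0) (N : ℕ) (w : ℝ≥0 → ℝ) (n : ℕ) (u : L2) :
    charge (lieScheme σ T N w (n + 1) u) = charge (lieScheme σ T N w n u) := by
  rw [lieScheme, charge_freeStep, charge_nlStep]

/-- In this form, invariance under every complex linear isometry is immediate. -/
theorem symplecticForm_eq_im_inner (h k : L2) : symplecticForm h k = (inner ℂ h k : ℂ).im := by
  rw [L2.inner_def]
  have him := integral_im (L2.integrable_inner (𝕜 := ℂ) h k)
  simp only [RCLike.im_eq_complex_im] at him
  rw [← him]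
  refine integral_congr_ae (Filter.Eventually.of_forall fun x => ?_)
  simp only [RCLike.inner_apply, Complex.mul_im, Complex.conj_re, Complex.conj_im]
  ring

theorem symplecticForm_freeStep (r : ℝ) (h k : L2) :
    symplecticForm (freeStep r h) (freeStep r k) = symplecticForm h k := by
  rw [symplecticForm_eq_im_inner, symplecticForm_eq_im_inner]
  exact congrArg Complex.im ((freeStepₗᵢ r).inner_map_map h k)

/-! ### The scheme on `H^s` -/

/-- The symbol has modulus one and multiplies the same Fourier transform as the weight, so the
weighted modulus is unchanged. -/
theorem Hs.exists_freeStep {s : ℝ} (r : ℝ) (u : Hs s) :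
    ∃ p : Hs s, p.toL2 = freeStep r u.toL2 ∧ ‖p‖ = ‖u‖ := by
  have hn : ∀ᵐ ξ, ‖(weight s ξ : ℂ) * (𝓕 (freeStep r u.toL2) : L2) ξ‖ =
      ‖(weight s ξ : ℂ) * (𝓕 u.toL2 : L2) ξ‖ := by
    filter_upwards [fourier_freeStep r u.toL2] with ξ hξ
    rw [hξ, norm_mul, norm_mul, norm_exp_I_mul_ofReal, one_mul, norm_mul]
  have hm : MemLp (fun ξ => (weight s ξ : ℂ) * (𝓕 (freeStep r u.toL2) : L2) ξ) 2
      (volume : Measure ℝ) :=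
    u.memLp_weight_mul_fourier.of_le
      ((Complex.continuous_ofReal.comp (continuous_weight s)).aestronglyMeasurable.mul
        (Lp.aestronglyMeasurable _)) (hn.mono fun ξ hξ => hξ.le)
  obtain ⟨p, hp, -⟩ := Hs.exists_of_fourier hm
  refine ⟨p, hp, ?_⟩
  have h1 : ENNReal.ofReal ‖p‖ = ENNReal.ofReal ‖u‖ := by
    rw [p.enorm_eq, u.enorm_eq, hp]
    exact eLpNorm_congr_norm_ae hn
  exact (ENNReal.ofReal_eq_ofReal_iff (norm_nonneg _) (norm_nonneg _)).mp h1

/-- The linear substep on `H^s`. -/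
def freeHsFun {s : ℝ} (r : ℝ) (u : Hs s) : Hs s := (Hs.exists_freeStep r u).choose

theorem toL2_freeHsFun {s : ℝ} (r : ℝ) (u : Hs s) :
    (freeHsFun r u).toL2 = freeStep r u.toL2 :=
  (Hs.exists_freeStep r u).choose_spec.1

/-- The linear substep as a continuous linear map on `H^s`. -/
def freeHs (s r : ℝ) : Hs s →L[ℂ] Hs s :=
  LinearMap.mkContinuous
    { toFun := freeHsFun r
      map_add' := fun u v => Hs.toL2_injective (by
        rw [map_add, toL2_freeHsFun, toL2_freeHsFun, toL2_freeHsFun, map_add]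
        exact (freeStepₗᵢ r).map_add _ _)
      map_smul' := fun c u => Hs.toL2_injective (by
        rw [map_smul, toL2_freeHsFun, toL2_freeHsFun, map_smul]
        exact (freeStepₗᵢ r).map_smul _ _) }
    1 (fun u => by rw [one_mul]; exact (Hs.exists_freeStep r u).choose_spec.2.le)

theorem toL2_freeHs {s : ℝ} (r : ℝ) (u : Hs s) : (freeHs s r u).toL2 = freeStep r u.toL2 :=
  toL2_freeHsFun r u

section Scheme

variable {s : ℝ} (hs : 1 / 2 < s) (σ : ℕ) (T : ℝ≥0) (N : ℕ) (w : ℝ≥0 → ℝ)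

/-- The Lie splitting scheme on `H^s`. -/
def lieHs : ℕ → Hs s → Hs s
  | 0, u => u
  | n + 1, u => freeHs s (increment w T N n) (nlHs hs σ ((T : ℝ) / N) (lieHs n u))

theorem toL2_lieHs (n : ℕ) (u : Hs s) :
    (lieHs hs σ T N w n u).toL2 = lieScheme σ T N w n u.toL2 := by
  induction n with
  | zero => rfl
  | succ n ih => rw [lieHs, lieScheme, toL2_freeHs, toL2_nlHs, ih]

theorem differentiable_lieHs (n : ℕ) : Differentiable ℝ (lieHs hs σ T N w n) := by
  induction n with
  | zero => exact differentiable_id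
  | succ n ih =>
    exact ((freeHs s (increment w T N n)).restrictScalars ℝ).differentiable.comp
      ((differentiable_nlHs hs σ _).comp ih)

theorem hasFDerivAt_lieScheme (n : ℕ) (u : Hs s) :
    HasFDerivAt (fun v : Hs s => lieScheme σ T N w n v.toL2)
      (((Hs.toL2CLM (by linarith : 0 ≤ s)).restrictScalars ℝ).comp
        (fderiv ℝ (lieHs hs σ T N w n) u)) u := by
  have h := ((Hs.toL2CLM (by linarith : 0 ≤ s)).restrictScalars ℝ).hasFDerivAt.comp u
    (differentiable_lieHs hs σ T N w n u).hasFDerivAt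
  have e : (fun v : Hs s => lieScheme σ T N w n v.toL2) =
      ((Hs.toL2CLM (by linarith : 0 ≤ s)).restrictScalars ℝ) ∘ lieHs hs σ T N w n := by
    ext1 v
    exact (toL2_lieHs hs σ T N w n v).symm
  rw [e]
  exact h

/-- The differential of the `L²`-valued scheme is the differential inside `H^s` followed by the
inclusion, so the chain rule can be applied within `H^s`. -/
theorem schemeForm_eq (n : ℕ) (u h k : Hs s) :
    schemeForm s σ T N w n u h k = symplecticForm (fderiv ℝ (lieHs hs σ T N w n) u h).toL2
      (fderiv ℝ (lieHs hs σ T N w n) u k).toL2 := by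
  rw [schemeForm, (hasFDerivAt_lieScheme hs σ T N w n u).fderiv]
  rfl

theorem fderiv_lieHs_succ (n : ℕ) (u h : Hs s) :
    fderiv ℝ (lieHs hs σ T N w (n + 1)) u h = freeHs s (increment w T N n)
      (fderiv ℝ (nlHs hs σ ((T : ℝ) / N)) (lieHs hs σ T N w n u)
        (fderiv ℝ (lieHs hs σ T N w n) u h)) := by
  have h1 := (differentiable_lieHs hs σ T N w n u).hasFDerivAt
  have h2 := (differentiable_nlHs hs σ ((T : ℝ) / N) (lieHs hs σ T N w n u)).hasFDerivAt
  have h3 := ((freeHs s (increment w T N n)).restrictScalars ℝ).hasFDerivAt.comp u (h2.comp u h1)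
  have e : lieHs hs σ T N w (n + 1) = ((freeHs s (increment w T N n)).restrictScalars ℝ) ∘
    (nlHs hs σ ((T : ℝ) / N) ∘ lieHs hs σ T N w n) := rfl
  rw [e, h3.fderiv]
  rfl

end Scheme

theorem schemeForm_succ {s : ℝ} (hs : 1 / 2 < s) (σ : ℕ) (T : ℝ≥0) (N : ℕ) (w : ℝ≥0 → ℝ)
    (n : ℕ) (u h k : Hs s) :
    schemeForm s σ T N w (n + 1) u h k = schemeForm s σ T N w n u h k := by
  rw [schemeForm_eq hs, schemeForm_eq hs, fderiv_lieHs_succ, fderiv_lieHs_succ, toL2_freeHs,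
    toL2_freeHs, symplecticForm_freeStep, symplecticForm_fderiv_nlHs]

/-! ### Derivatives of square integrable functions on the Fourier side -/

theorem toTemperedDistribution_apply_eq_integral_fourier (f : L2) (φ : 𝓢(ℝ, ℂ)) :
    (f : 𝓢'(ℝ, ℂ)) φ = ∫ ξ, (𝓕⁻ φ) ξ * (𝓕 f : L2) ξ := by
  rw [integral_schwartz_mul_fourier, FourierTransform.fourier_fourierInv_eq]
  simp

theorem fourierMultiplierCLM_apply_eq_integral {g : ℝ → ℂ} (hg : g.HasTemperateGrowth) (f : L2)
    (φ : 𝓢(ℝ, ℂ)) :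
    TemperedDistribution.fourierMultiplierCLM ℂ g (f : 𝓢'(ℝ, ℂ)) φ =
      ∫ ξ, g ξ * (𝓕⁻ φ) ξ * (𝓕 f : L2) ξ := by
  rw [TemperedDistribution.fourierMultiplierCLM_apply, fourierInv_apply, smulLeftCLM_apply_apply,
    Lp.fourier_toTemperedDistribution_eq, Lp.toTemperedDistribution_apply]
  simp only [SchwartzMap.smulLeftCLM_apply_apply hg, smul_eq_mul]

theorem laplacian_apply_eq_integral (f : L2) (φ : 𝓢(ℝ, ℂ)) :
    (Δ (f : 𝓢'(ℝ, ℂ))) φ =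
      ∫ ξ, -(((2 * Real.pi * ξ) ^ 2 : ℝ) : ℂ) * (𝓕⁻ φ) ξ * (𝓕 f : L2) ξ := by
  have h := fourierMultiplierCLM_apply_eq_integral
    (g := fun ξ : ℝ => Complex.ofReal (‖ξ‖ ^ 2)) (by fun_prop) f φ
  rw [TemperedDistribution.laplacian_eq_fourierMultiplierCLM]
  change (-(2 * Real.pi) ^ 2 : ℝ) • (TemperedDistribution.fourierMultiplierCLM ℂ
    (fun ξ : ℝ => Complex.ofReal (‖ξ‖ ^ 2)) (f : 𝓢'(ℝ, ℂ)) φ) = _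
  rw [h, ← integral_smul]
  congr 1; ext ξ
  simp only [Complex.real_smul, Real.norm_eq_abs, sq_abs]
  push_cast
  ring

theorem lineDeriv_apply_eq_integral (f : L2) (φ : 𝓢(ℝ, ℂ)) :
    (∂_{(1 : ℝ)} (f : 𝓢'(ℝ, ℂ))) φ =
      ∫ ξ, 2 * Real.pi * Complex.I * ξ * (𝓕⁻ φ) ξ * (𝓕 f : L2) ξ := by
  have h := fourierMultiplierCLM_apply_eq_integral
    (g := fun ξ : ℝ => ((inner ℝ ξ (1 : ℝ) : ℝ) : ℂ)) (by fun_prop) f φ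
  rw [TemperedDistribution.lineDeriv_eq_fourierMultiplierCLM]
  change (2 * Real.pi * Complex.I) • (TemperedDistribution.fourierMultiplierCLM ℂ
    (fun ξ : ℝ => ((inner ℝ ξ (1 : ℝ) : ℝ) : ℂ)) (f : 𝓢'(ℝ, ℂ)) φ) = _
  rw [h, ← integral_smul]
  congr 1; ext ξ
  simp
  ring

theorem eq_laplacian_of_fourier {f g : L2}
    (h : (𝓕 g : L2) =ᵐ[volume] fun ξ => -(((2 * Real.pi * ξ) ^ 2 : ℝ) : ℂ) * (𝓕 f : L2) ξ) :
    (g : 𝓢'(ℝ, ℂ)) = Δ (f : 𝓢'(ℝ, ℂ)) := by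
  ext φ
  rw [laplacian_apply_eq_integral, toTemperedDistribution_apply_eq_integral_fourier]
  refine integral_congr_ae ?_
  filter_upwards [h] with ξ hξ
  rw [hξ]
  ring

/-- The choice made in `weakDeriv` is unique since `L²` embeds injectively in the tempered
distributions. -/
theorem weakDeriv_eq_of_fourier {f g : L2}
    (h : (𝓕 g : L2) =ᵐ[volume] fun ξ => 2 * Real.pi * Complex.I * ξ * (𝓕 f : L2) ξ) :
    weakDeriv f = g := by
  have h1 : ∂_{(1 : ℝ)} (f : 𝓢'(ℝ, ℂ)) = (g : 𝓢'(ℝ, ℂ)) := by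
    ext φ
    rw [lineDeriv_apply_eq_integral, toTemperedDistribution_apply_eq_integral_fourier]
    refine integral_congr_ae ?_
    filter_upwards [h] with ξ hξ
    rw [hξ]
    ring
  have h2 : ∃ g : L2, ∂_{(1 : ℝ)} (f : 𝓢'(ℝ, ℂ)) = (g : 𝓢'(ℝ, ℂ)) := ⟨g, h1⟩
  rw [weakDeriv, dif_pos h2]
  exact toTemperedDistribution_injective (h2.choose_spec.symm.trans h1)

/-! ### The Hamiltonian `H₁` -/

theorem weight_two (ξ : ℝ) : weight 2 ξ = 1 + ξ ^ 2 := by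
  simp [weight]

theorem Hs.memLp_multiplier_mul_fourier (u : Hs 2) {m : ℝ → ℂ} (hm : Continuous m) {C : ℝ}
    (h : ∀ ξ, ‖m ξ‖ ≤ C * (1 + ξ ^ 2)) :
    MemLp (fun ξ => m ξ * (𝓕 u.toL2 : L2) ξ) 2 (volume : Measure ℝ) := by
  refine u.memLp_weight_mul_fourier.of_le_mul (c := C)
    (hm.aestronglyMeasurable.mul (Lp.aestronglyMeasurable _))
    (Filter.Eventually.of_forall fun ξ => ?_)
  rw [norm_mul, norm_mul, Complex.norm_real, Real.norm_of_nonneg (weight_pos 2 ξ).le, weight_two,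
    ← mul_assoc]
  exact mul_le_mul_of_nonneg_right (h ξ) (norm_nonneg _)

theorem Hs.memLp_sq_mul_fourier (u : Hs 2) :
    MemLp (fun ξ => -(((2 * Real.pi * ξ) ^ 2 : ℝ) : ℂ) * (𝓕 u.toL2 : L2) ξ) 2
      (volume : Measure ℝ) := by
  refine u.memLp_multiplier_mul_fourier (by fun_prop) (C := (2 * Real.pi) ^ 2) fun ξ => ?_
  rw [norm_neg, Complex.norm_real, Real.norm_of_nonneg (by positivity), mul_pow]
  gcongr
  linarith

theorem Hs.memLp_id_mul_fourier (u : Hs 2) :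
    MemLp (fun ξ => 2 * Real.pi * Complex.I * ξ * (𝓕 u.toL2 : L2) ξ) 2 (volume : Measure ℝ) := by
  refine u.memLp_multiplier_mul_fourier (by fun_prop) (C := 2 * Real.pi) fun ξ => ?_
  simp only [norm_mul, Complex.norm_I, Complex.norm_real, RCLike.norm_ofNat,
    Real.norm_of_nonneg Real.pi_pos.le, mul_one, Real.norm_eq_abs]
  gcongr
  nlinarith [sq_abs ξ, abs_nonneg ξ, sq_nonneg (|ξ| - 1)]

/-- The Laplacian of a function of `H²`. -/
def laplacianL2 (u : Hs 2) : L2 := 𝓕⁻ u.memLp_sq_mul_fourier.toLp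

theorem fourier_laplacianL2 (u : Hs 2) :
    (𝓕 (laplacianL2 u) : L2) =ᵐ[volume]
      fun ξ => -(((2 * Real.pi * ξ) ^ 2 : ℝ) : ℂ) * (𝓕 u.toL2 : L2) ξ := by
  rw [laplacianL2, FourierTransform.fourier_fourierInv_eq]
  exact u.memLp_sq_mul_fourier.coeFn_toLp

theorem fourier_weakDeriv (u : Hs 2) :
    (𝓕 (weakDeriv u.toL2) : L2) =ᵐ[volume]
      fun ξ => 2 * Real.pi * Complex.I * ξ * (𝓕 u.toL2 : L2) ξ := by
  have h : (𝓕 (𝓕⁻ u.memLp_id_mul_fourier.toLp : L2) : L2) =ᵐ[volume]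
      fun ξ => 2 * Real.pi * Complex.I * ξ * (𝓕 u.toL2 : L2) ξ := by
    rw [FourierTransform.fourier_fourierInv_eq]
    exact u.memLp_id_mul_fourier.coeFn_toLp
  rw [weakDeriv_eq_of_fourier h]
  exact h

theorem weakDeriv_add_smul (u h : Hs 2) (ε : ℝ) :
    weakDeriv (u.toL2 + ε • h.toL2) = weakDeriv u.toL2 + ε • weakDeriv h.toL2 := by
  have lin : ∀ f g : L2, (𝓕 (f + ε • g) : L2) =ᵐ[volume]
      fun ξ => (𝓕 f : L2) ξ + ε * (𝓕 g : L2) ξ := by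
    intro f g
    have e : (𝓕 (f + ε • g) : L2) = 𝓕 f + (ε : ℂ) • 𝓕 g := by
      rw [FourierTransform.fourier_add, ← FourierTransform.fourier_smul]
      rfl
    rw [e]
    filter_upwards [Lp.coeFn_add (𝓕 f : L2) ((ε : ℂ) • 𝓕 g),
      Lp.coeFn_smul (ε : ℂ) (𝓕 g : L2)] with ξ h1 h2
    rw [h1, Pi.add_apply, h2, Pi.smul_apply, smul_eq_mul]
  refine weakDeriv_eq_of_fourier ?_
  filter_upwards [lin (weakDeriv u.toL2) (weakDeriv h.toL2), lin u.toL2 h.toL2,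
    fourier_weakDeriv u, fourier_weakDeriv h] with ξ h1 h2 h3 h4
  rw [h1, h2, h3, h4]
  ring

/-- Integration by parts, done by Plancherel: the symbol `2πiξ` times its conjugate is `(2πξ)²`. -/
theorem inner_weakDeriv (u h : Hs 2) :
    (inner ℂ (weakDeriv u.toL2) (weakDeriv h.toL2) : ℂ) =
      -inner ℂ (laplacianL2 u) h.toL2 := by
  rw [← Lp.inner_fourier_eq, ← Lp.inner_fourier_eq (laplacianL2 u), L2.inner_def, L2.inner_def,
    ← integral_neg]
  refine integral_congr_ae ?_
  filter_upwards [fourier_weakDeriv u, fourier_weakDeriv h, fourier_laplacianL2 u]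
    with ξ h1 h2 h3
  rw [h1, h2, h3]
  simp only [RCLike.inner_apply, map_mul, map_neg, Complex.conj_ofReal, Complex.conj_I,
    Complex.conj_ofNat]
  push_cast
  linear_combination (-(4 * Real.pi ^ 2 * ξ ^ 2 * (𝓕 h.toL2 : L2) ξ *
    (starRingEnd ℂ) ((𝓕 u.toL2 : L2) ξ)) : ℂ) * Complex.I_sq

theorem energyH1_eq (f : L2) : energyH1 f = -(1 / 2) * ‖weakDeriv f‖ ^ 2 := by
  rw [energyH1, ← charge_eq_norm_sq]
  rfl

/-- The energy is a quadratic form in the weak derivative, so its derivative in the direction `h` is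
minus the real part of `⟨∇u, ∇h⟩`, to which `inner_weakDeriv` applies. -/
theorem hasVariationalDerivative_energyH1 (u : Hs 2) :
    HasVariationalDerivative energyH1 u.toL2 (laplacianL2 u) := by
  intro φ
  set h : Hs 2 := Hs.ofSchwartz 2 φ with hh
  set a := weakDeriv u.toL2 with ha
  set b := weakDeriv h.toL2 with hb
  have hsq : ∀ f : L2, ‖f‖ ^ 2 = (inner ℂ f f : ℂ).re := fun f => by
    rw [inner_self_eq_norm_sq_to_K]
    norm_cast
  have e : (fun ε : ℝ => energyH1 (u.toL2 + ε • φ.toLp 2 (volume : Measure ℝ))) =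
      fun ε : ℝ => -(1 / 2) * (inner ℂ (a + ε • b) (a + ε • b) : ℂ).re := by
    ext ε
    rw [energyH1_eq, ← Hs.toL2_ofSchwartz (s := 2), weakDeriv_add_smul, hsq]
  rw [e]
  have h1 : HasDerivAt (fun ε : ℝ => a + ε • b) b 0 := by
    simpa using ((hasDerivAt_id (0 : ℝ)).smul_const b).const_add a
  have h2 := Complex.reCLM.hasFDerivAt.comp_hasDerivAt (0 : ℝ) (h1.inner ℂ h1)
  rw [zero_smul, add_zero] at h2
  refine (h2.const_mul (-(1 / 2))).congr_deriv ?_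
  have h3 : (inner ℂ b a : ℂ).re = (inner ℂ a b : ℂ).re := by
    rw [← inner_conj_symm, Complex.conj_re]
  rw [map_add, Complex.reCLM_apply, Complex.reCLM_apply, h3, inner_weakDeriv, L2.inner_def,
    Complex.neg_re]
  have hre := integral_re (L2.integrable_inner (𝕜 := ℂ) (laplacianL2 u) h.toL2)
  simp only [RCLike.re_eq_complex_re] at hre
  rw [← hre]
  have hφ : h.toL2 =ᵐ[volume] φ := φ.coeFn_toLp 2 volume
  have e2 : ∫ x, (inner ℂ (laplacianL2 u x) (h.toL2 x) : ℂ).re =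
      ∫ x, ((laplacianL2 u x).re * (φ x).re + (laplacianL2 u x).im * (φ x).im) := by
    refine integral_congr_ae ?_
    filter_upwards [hφ] with x hx
    rw [hx]
    simp only [RCLike.inner_apply, Complex.mul_re, Complex.conj_re, Complex.conj_im]
    ring
  rw [e2]
  ring

/-! ### The flow of the linear equation -/

open Filter Topology in
/-- Dominated convergence in `L²`. -/
theorem tendsto_L2_of_dominated {ι : Type*} {l : Filter ι} [l.IsCountablyGenerated]
    {f : ι → L2} {g : L2} {F : ι → ℝ → ℂ} {G : ℝ → ℂ} {b : ℝ → ℝ}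
    (hb : MemLp b 2 (volume : Measure ℝ)) (hF : ∀ i, f i =ᵐ[volume] F i) (hG : g =ᵐ[volume] G)
    (hbound : ∀ᶠ i in l, ∀ᵐ x, ‖F i x - G x‖ ≤ b x)
    (hlim : ∀ᵐ x, Tendsto (fun i => F i x) l (𝓝 (G x))) : Tendsto f l (𝓝 g) := by
  have h1 : ∀ i, ‖f i - g‖ ^ 2 = ∫ x, ‖F i x - G x‖ ^ 2 := by
    intro i
    rw [← charge_eq_norm_sq, charge]
    refine integral_congr_ae ?_
    filter_upwards [Lp.coeFn_sub (f i) g, hF i, hG] with x h1 h2 h3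
    rw [h1, Pi.sub_apply, h2, h3]
  have h2 : Tendsto (fun i => ‖f i - g‖ ^ 2) l (𝓝 (∫ _ : ℝ, (0 : ℝ))) := by
    simp only [h1]
    refine tendsto_integral_filter_of_dominated_convergence (fun x => b x ^ 2) ?_ ?_
      hb.integrable_sq ?_
    · filter_upwards with i
      have hi : AEStronglyMeasurable (fun x => F i x - G x) volume :=
        ((Lp.aestronglyMeasurable (f i)).congr (hF i)).sub ((Lp.aestronglyMeasurable g).congr hG)
      exact hi.norm.pow 2
    · filter_upwards [hbound] with i hi
      filter_upwards [hi] with x hx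
      rw [Real.norm_of_nonneg (by positivity)]
      gcongr
    · filter_upwards [hlim] with x hx
      have h3 := (tendsto_iff_norm_sub_tendsto_zero.mp hx).pow 2
      simpa using h3
  rw [integral_zero] at h2
  rw [tendsto_iff_norm_sub_tendsto_zero]
  have h3 := h2.sqrt
  simpa [Real.sqrt_sq (norm_nonneg _)] using h3

/-- The symbol of the linear substep. -/
def freeSymbol (r ξ : ℝ) : ℂ := Complex.exp (Complex.I * ((-r * (2 * Real.pi * ξ) ^ 2 : ℝ) : ℂ))

theorem norm_freeSymbol (r ξ : ℝ) : ‖freeSymbol r ξ‖ = 1 := norm_exp_I_mul_ofReal _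

theorem hasDerivAt_freeSymbol (r ξ : ℝ) :
    HasDerivAt (fun r => freeSymbol r ξ)
      (Complex.I * (-(((2 * Real.pi * ξ) ^ 2 : ℝ) : ℂ) * freeSymbol r ξ)) r := by
  unfold freeSymbol
  have h1 := (((hasDerivAt_id r).neg.mul_const ((2 * Real.pi * ξ) ^ 2)).ofReal_comp).const_mul
    Complex.I
  refine h1.cexp.congr_deriv ?_
  simp only [Pi.neg_apply, id_eq, neg_mul, one_mul]
  push_cast
  ring

/-- From `|e^{ix} - 1| ≤ |x|`. It bounds the difference quotients in time by `(2πξ)²`, which is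
square integrable against the transform of a function of `H²`. -/
theorem norm_freeSymbol_sub_le (r r' ξ : ℝ) :
    ‖freeSymbol r ξ - freeSymbol r' ξ‖ ≤ |r - r'| * (2 * Real.pi * ξ) ^ 2 := by
  have e : freeSymbol r ξ - freeSymbol r' ξ = freeSymbol r' ξ *
      (Complex.exp (Complex.I * ((-(r - r') * (2 * Real.pi * ξ) ^ 2 : ℝ) : ℂ)) - 1) := by
    unfold freeSymbol
    rw [mul_sub, ← Complex.exp_add, mul_one]
    congr 2
    push_cast
    ring
  rw [e, norm_mul, norm_freeSymbol, one_mul]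
  refine Real.norm_exp_I_mul_ofReal_sub_one_le.trans (le_of_eq ?_)
  rw [norm_mul, norm_neg, Real.norm_eq_abs, Real.norm_of_nonneg (by positivity)]

theorem continuous_freeStep (f : L2) : Continuous fun r => freeStep r f := by
  rw [continuous_iff_continuousAt]
  intro r₀
  refine ((Lp.fourierTransformₗᵢ ℝ ℂ).symm.continuous.tendsto _).comp ?_
  refine tendsto_L2_of_dominated (F := fun r ξ => freeSymbol r ξ * (𝓕 f : L2) ξ)
    (G := fun ξ => freeSymbol r₀ ξ * (𝓕 f : L2) ξ) (b := fun ξ => 2 * ‖(𝓕 f : L2) ξ‖)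
    ((Lp.memLp (𝓕 f : L2)).norm.const_mul 2) (fun r => coeFn_phaseMul _ _ _)
    (coeFn_phaseMul _ _ _) ?_ ?_
  · filter_upwards with r
    filter_upwards with ξ
    rw [← sub_mul, norm_mul]
    gcongr
    refine (norm_sub_le _ _).trans ?_
    rw [norm_freeSymbol, norm_freeSymbol]
    norm_num
  · filter_upwards with ξ
    exact ((hasDerivAt_freeSymbol r₀ ξ).continuousAt.tendsto).mul_const _

theorem hasDerivAt_freeStep (u : Hs 2) (r₀ : ℝ) :
    HasDerivAt (fun r => freeStep r u.toL2) (Complex.I • laplacianL2 (freeHs 2 r₀ u)) r₀ := by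
  have key : HasDerivAt (fun r => phaseMul (fun ξ => -r * (2 * Real.pi * ξ) ^ 2)
      (aemeasurable_freePhase r) (𝓕 u.toL2)) (𝓕 (Complex.I • laplacianL2 (freeHs 2 r₀ u)) : L2)
      r₀ := by
    have hsq := u.memLp_sq_mul_fourier
    rw [hasDerivAt_iff_tendsto_slope]
    refine tendsto_L2_of_dominated
      (F := fun r ξ => slope (fun r => freeSymbol r ξ) r₀ r * (𝓕 u.toL2 : L2) ξ)
      (G := fun ξ => Complex.I * (-(((2 * Real.pi * ξ) ^ 2 : ℝ) : ℂ) * freeSymbol r₀ ξ) *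
        (𝓕 u.toL2 : L2) ξ)
      (b := fun ξ => 2 * ‖-(((2 * Real.pi * ξ) ^ 2 : ℝ) : ℂ) * (𝓕 u.toL2 : L2) ξ‖)
      (hsq.norm.const_mul 2) (fun r => ?_) ?_ ?_ ?_
    · simp only [slope_def_module]
      set p := fun r => phaseMul (fun ξ => -r * (2 * Real.pi * ξ) ^ 2)
        (aemeasurable_freePhase r) (𝓕 u.toL2) with hp
      have hpc : ∀ r, p r =ᵐ[volume] fun ξ => freeSymbol r ξ * (𝓕 u.toL2 : L2) ξ :=
        fun r => coeFn_phaseMul _ _ _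
      filter_upwards [Lp.coeFn_smul ((r - r₀)⁻¹) (p r - p r₀), Lp.coeFn_sub (p r) (p r₀), hpc r,
        hpc r₀] with ξ h1 h2 h3 h4
      rw [h1, Pi.smul_apply, h2, Pi.sub_apply, h3, h4, ← sub_mul, smul_mul_assoc]
    · rw [FourierTransform.fourier_smul]
      filter_upwards [Lp.coeFn_smul Complex.I (𝓕 (laplacianL2 (freeHs 2 r₀ u)) : L2),
        fourier_laplacianL2 (freeHs 2 r₀ u), fourier_freeStep r₀ u.toL2] with ξ h1 h2 h3
      rw [h1, Pi.smul_apply, h2, toL2_freeHs, h3, freeSymbol, smul_eq_mul]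
      ring
    -- The factor `2` in the dominating function: one for the difference quotient and one for its
    -- limit.
    · filter_upwards [self_mem_nhdsWithin] with r hr
      filter_upwards with ξ
      have hne : 0 < |r - r₀| := abs_pos.mpr (sub_ne_zero.mpr hr)
      rw [← sub_mul, norm_mul, norm_mul, ← mul_assoc (2 : ℝ)]
      refine mul_le_mul_of_nonneg_right ?_ (norm_nonneg ((𝓕 u.toL2 : L2) ξ))
      refine (norm_sub_le _ _).trans ?_
      have h1 : ‖slope (fun r => freeSymbol r ξ) r₀ r‖ ≤ (2 * Real.pi * ξ) ^ 2 := by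
        rw [slope_def_module, norm_smul, norm_inv, Real.norm_eq_abs, inv_mul_le_iff₀ hne]
        exact norm_freeSymbol_sub_le r r₀ ξ
      rw [norm_mul, norm_mul, Complex.norm_I, norm_freeSymbol, norm_neg, Complex.norm_real,
        Real.norm_of_nonneg (by positivity : 0 ≤ (2 * Real.pi * ξ) ^ 2)]
      linarith
    · filter_upwards with ξ
      exact ((hasDerivAt_iff_tendsto_slope.mp (hasDerivAt_freeSymbol r₀ ξ)).mul_const _)
  have h := ((Lp.fourierTransformₗᵢ ℝ
    ℂ).symm.toContinuousLinearEquiv.toContinuousLinearMap.restrictScalars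
    ℝ).hasFDerivAt.comp_hasDerivAt r₀ key
  refine h.congr_deriv ?_
  exact (Lp.fourierTransformₗᵢ ℝ ℂ).symm_apply_apply (Complex.I • laplacianL2 (freeHs 2 r₀ u))

theorem freeStep_zero (f : L2) : freeStep 0 f = f := by
  have h : phaseMul (fun ξ => -0 * (2 * Real.pi * ξ) ^ 2) (aemeasurable_freePhase 0) (𝓕 f) =
      𝓕 f := by
    refine Lp.ext ?_
    filter_upwards [coeFn_phaseMul _ (aemeasurable_freePhase 0) (𝓕 f)] with ξ hξ
    rw [hξ]
    simp
  rw [freeStep, h, FourierTransform.fourierInv_fourier_eq]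

theorem linear_flow {v : L2} (hv : MemSobolev 2 2 (v : 𝓢'(ℝ, ℂ))) (r : ℝ) :
    ∃ g : L2, (g : 𝓢'(ℝ, ℂ)) = Δ (freeStep r v : 𝓢'(ℝ, ℂ)) ∧
      HasVariationalDerivative energyH1 (freeStep r v) g ∧
      HasDerivAt (fun r : ℝ => freeStep r v) (Complex.I • g) r := by
  set u : Hs 2 := ⟨v, hv⟩ with hu
  have e : (freeHs 2 r u).toL2 = freeStep r v := toL2_freeHs r u
  refine ⟨laplacianL2 (freeHs 2 r u), ?_, ?_, hasDerivAt_freeStep u r⟩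
  · rw [← e]
    exact eq_laplacian_of_fourier (fourier_laplacianL2 _)
  · rw [← e]
    exact hasVariationalDerivative_energyH1 _

/-! ### The trapezoidal rule along the linear flow -/

/-- For `|β| ≤ 1` the trapezoidal rule agrees with the Taylor expansion through second order; for
`|β| ≥ 1` the trivial bound `2 + |β|` is at most `3|β|³`. A bound for all `β` is needed because
Brownian increments are unbounded. -/
theorem norm_exp_trapezoid_le (β : ℝ) :
    ‖Complex.exp (Complex.I * β) - 1 - Complex.I * β / 2 * (1 + Complex.exp (Complex.I * β))‖ ≤
      5 * |β| ^ 3 := by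
  have hx : ‖Complex.I * (β : ℂ)‖ = |β| := by simp
  rcases le_total |β| 1 with h | h
  · have h3 := Complex.norm_exp_sub_sum_le_norm_mul_exp (Complex.I * β) 3
    have h2 := Complex.norm_exp_sub_sum_le_norm_mul_exp (Complex.I * β) 2
    rw [hx] at h2 h3
    set R3 := Complex.exp (Complex.I * β) -
      ∑ m ∈ Finset.range 3, (Complex.I * (β : ℂ)) ^ m / (m.factorial : ℂ) with hR3
    set R2 := Complex.exp (Complex.I * β) -
      ∑ m ∈ Finset.range 2, (Complex.I * (β : ℂ)) ^ m / (m.factorial : ℂ) with hR2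
    -- The polynomial parts cancel. With `e^{|β|} ≤ 3` the remainders contribute `3 + 3/2 ≤ 5`.
    have e : Complex.exp (Complex.I * β) - 1 -
        Complex.I * β / 2 * (1 + Complex.exp (Complex.I * β)) =
        R3 - Complex.I * β / 2 * R2 := by
      rw [hR3, hR2]
      simp only [Finset.sum_range_succ, Finset.range_zero, Finset.sum_empty, Nat.factorial]
      push_cast
      ring
    have he : Real.exp |β| ≤ 3 :=
      (Real.exp_le_exp.mpr h).trans (by have := Real.exp_one_lt_d9; linarith)
    have hb := abs_nonneg β
    rw [e]
    calc ‖R3 - Complex.I * β / 2 * R2‖ ≤ ‖R3‖ + |β| / 2 * ‖R2‖ := by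
          refine (norm_sub_le _ _).trans (le_of_eq ?_)
          rw [norm_mul, norm_div, hx]
          simp
      _ ≤ |β| ^ 3 * 3 + |β| / 2 * (|β| ^ 2 * 3) := by
          have e3 : |β| ^ 3 * Real.exp |β| ≤ |β| ^ 3 * 3 := by gcongr
          have e2 : |β| ^ 2 * Real.exp |β| ≤ |β| ^ 2 * 3 := by gcongr
          have := mul_le_mul_of_nonneg_left (h2.trans e2) (by positivity : 0 ≤ |β| / 2)
          linarith
      _ ≤ 5 * |β| ^ 3 := by nlinarith [pow_nonneg hb 3]
  · have h1 : ‖Complex.exp (Complex.I * β)‖ = 1 := norm_exp_I_mul_ofReal β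
    calc _ ≤ ‖Complex.exp (Complex.I * β)‖ + ‖(1 : ℂ)‖ + ‖Complex.I * (β : ℂ) / 2‖ *
          (‖(1 : ℂ)‖ + ‖Complex.exp (Complex.I * β)‖) := by
          refine (norm_sub_le _ _).trans ?_
          rw [norm_mul]
          gcongr
          · exact norm_sub_le _ _
          · exact norm_add_le _ _
      _ = 2 + |β| := by
          rw [norm_div, hx, h1]
          simp
          ring
      _ ≤ 5 * |β| ^ 3 := by
          have : |β| ≤ |β| ^ 3 := le_self_pow₀ h (by norm_num)
          linarith

/-- The symbol `(2πξ)²` of `-Δ`. -/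
def negLaplaceSymbol (ξ : ℝ) : ℝ := (2 * Real.pi * ξ) ^ 2

theorem norm_freeSymbol_trapezoid_le (y y' ξ : ℝ) :
    ‖freeSymbol y' ξ - freeSymbol y ξ + Complex.I * negLaplaceSymbol ξ *
      ((freeSymbol y ξ + freeSymbol y' ξ) / 2) * ((y' - y : ℝ) : ℂ)‖ ≤
      5 * |y' - y| ^ 3 * negLaplaceSymbol ξ ^ 3 := by
  set β : ℝ := -(y' - y) * negLaplaceSymbol ξ with hβ
  have h1 : freeSymbol y' ξ = freeSymbol y ξ * Complex.exp (Complex.I * β) := by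
    unfold freeSymbol
    rw [← Complex.exp_add, hβ, negLaplaceSymbol]
    congr 1
    push_cast
    ring
  have e : freeSymbol y' ξ - freeSymbol y ξ + Complex.I * negLaplaceSymbol ξ *
      ((freeSymbol y ξ + freeSymbol y' ξ) / 2) * ((y' - y : ℝ) : ℂ) =
      freeSymbol y ξ * (Complex.exp (Complex.I * β) - 1 -
        Complex.I * β / 2 * (1 + Complex.exp (Complex.I * β))) := by
    rw [h1, hβ]
    push_cast
    ring
  rw [e, norm_mul, norm_freeSymbol, one_mul]
  refine (norm_exp_trapezoid_le β).trans (le_of_eq ?_)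
  have hm : 0 ≤ negLaplaceSymbol ξ := by unfold negLaplaceSymbol; positivity
  rw [hβ, abs_mul, abs_neg, abs_of_nonneg hm]
  ring

/-- The Schwartz function `(2πξ)^{2k} 𝓕⁻ φ(ξ)`. -/
def weightedSchwartz (k : ℕ) (φ : 𝓢(ℝ, ℂ)) : 𝓢(ℝ, ℂ) :=
  SchwartzMap.smulLeftCLM ℂ (fun ξ : ℝ => ((negLaplaceSymbol ξ ^ k : ℝ) : ℂ)) (𝓕⁻ φ)

theorem weightedSchwartz_apply (k : ℕ) (φ : 𝓢(ℝ, ℂ)) (ξ : ℝ) :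
    weightedSchwartz k φ ξ = ((negLaplaceSymbol ξ ^ k : ℝ) : ℂ) * (𝓕⁻ φ) ξ := by
  rw [weightedSchwartz, SchwartzMap.smulLeftCLM_apply_apply, smul_eq_mul]
  unfold negLaplaceSymbol
  fun_prop

theorem integrable_weightedSchwartz_mul (k : ℕ) (φ : 𝓢(ℝ, ℂ)) (f : L2) (y : ℝ) :
    Integrable fun ξ => weightedSchwartz k φ ξ * (freeSymbol y ξ * (𝓕 f : L2) ξ) := by
  have h2 : MemLp (fun ξ => freeSymbol y ξ * (𝓕 f : L2) ξ) 2 (volume : Measure ℝ) :=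
    memLp_phase _ (aemeasurable_freePhase y) (𝓕 f)
  exact ((weightedSchwartz k φ).memLp 2 volume).integrable_mul h2

/-- The constant of the trapezoidal rule for the test function `φ`. -/
def trapezoidConst (φ : 𝓢(ℝ, ℂ)) : ℝ := 5 * √(∫ ξ, ‖weightedSchwartz 3 φ ξ‖ ^ 2)

theorem trapezoidConst_nonneg (φ : 𝓢(ℝ, ℂ)) : 0 ≤ trapezoidConst φ := by
  unfold trapezoidConst; positivity

theorem integral_norm_mul_norm_le (χ : 𝓢(ℝ, ℂ)) (f : L2) :
    ∫ ξ, ‖χ ξ‖ * ‖f ξ‖ ≤ √(∫ ξ, ‖χ ξ‖ ^ 2) * ‖f‖ := by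
  have h := integral_mul_norm_le_Lp_mul_Lq (μ := (volume : Measure ℝ))
    Real.HolderConjugate.two_two (f := χ) (g := f) (by simpa using χ.memLp 2 volume)
    (by simpa using Lp.memLp f)
  refine h.trans (le_of_eq ?_)
  simp only [Real.rpow_two, ← Real.sqrt_eq_rpow]
  congr 1
  have := charge_eq_norm_sq f
  rw [charge] at this
  rw [this, Real.sqrt_sq (norm_nonneg _)]

/-- The cubic error costs three powers of the symbol of `-Δ`. They are absorbed by the transform of
the test function, so `f` need only lie in `L²`; Cauchy–Schwarz gives the constant. -/
theorem norm_freeStep_trapezoid_le (f : L2) (φ : 𝓢(ℝ, ℂ)) (y y' : ℝ) :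
    ‖(Complex.I * (Δ (freeStep y f : 𝓢'(ℝ, ℂ))) φ + Complex.I * (Δ (freeStep y' f : 𝓢'(ℝ, ℂ))) φ)
        / 2 * ((y' - y : ℝ) : ℂ) -
      ((freeStep y' f : 𝓢'(ℝ, ℂ)) φ - (freeStep y f : 𝓢'(ℝ, ℂ)) φ)‖ ≤
      trapezoidConst φ * ‖f‖ * |y' - y| ^ 3 := by
  have hT : ∀ y, (freeStep y f : 𝓢'(ℝ, ℂ)) φ =
      ∫ ξ, weightedSchwartz 0 φ ξ * (freeSymbol y ξ * (𝓕 f : L2) ξ) := by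
    intro y
    rw [toTemperedDistribution_apply_eq_integral_fourier]
    refine integral_congr_ae ?_
    filter_upwards [fourier_freeStep y f] with ξ hξ
    rw [hξ, weightedSchwartz_apply, freeSymbol]
    simp
  have hX : ∀ y, (Δ (freeStep y f : 𝓢'(ℝ, ℂ))) φ =
      -∫ ξ, weightedSchwartz 1 φ ξ * (freeSymbol y ξ * (𝓕 f : L2) ξ) := by
    intro y
    rw [laplacian_apply_eq_integral, ← integral_neg]
    refine integral_congr_ae ?_
    filter_upwards [fourier_freeStep y f] with ξ hξ
    rw [hξ, weightedSchwartz_apply, freeSymbol, negLaplaceSymbol, pow_one]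
    ring
  have i0 := integrable_weightedSchwartz_mul 0 φ f
  have i1 := integrable_weightedSchwartz_mul 1 φ f
  have e : (Complex.I * (Δ (freeStep y f : 𝓢'(ℝ, ℂ))) φ +
        Complex.I * (Δ (freeStep y' f : 𝓢'(ℝ, ℂ))) φ) / 2 * ((y' - y : ℝ) : ℂ) -
      ((freeStep y' f : 𝓢'(ℝ, ℂ)) φ - (freeStep y f : 𝓢'(ℝ, ℂ)) φ) =
      -∫ ξ, (𝓕⁻ φ) ξ * (𝓕 f : L2) ξ * (freeSymbol y' ξ - freeSymbol y ξ +
        Complex.I * negLaplaceSymbol ξ * ((freeSymbol y ξ + freeSymbol y' ξ) / 2) *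
          ((y' - y : ℝ) : ℂ)) := by
    have e1 : ∀ ξ, (𝓕⁻ φ) ξ * (𝓕 f : L2) ξ * (freeSymbol y' ξ - freeSymbol y ξ +
        Complex.I * negLaplaceSymbol ξ * ((freeSymbol y ξ + freeSymbol y' ξ) / 2) *
          ((y' - y : ℝ) : ℂ)) =
        (weightedSchwartz 0 φ ξ * (freeSymbol y' ξ * (𝓕 f : L2) ξ) -
          weightedSchwartz 0 φ ξ * (freeSymbol y ξ * (𝓕 f : L2) ξ)) +
        (Complex.I / 2 * ((y' - y : ℝ) : ℂ)) *
          (weightedSchwartz 1 φ ξ * (freeSymbol y ξ * (𝓕 f : L2) ξ) +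
            weightedSchwartz 1 φ ξ * (freeSymbol y' ξ * (𝓕 f : L2) ξ)) := by
      intro ξ
      simp only [weightedSchwartz_apply, pow_zero, pow_one, Complex.ofReal_one]
      ring
    simp only [e1]
    have j0 : Integrable fun ξ => weightedSchwartz 0 φ ξ * (freeSymbol y' ξ * (𝓕 f : L2) ξ) -
        weightedSchwartz 0 φ ξ * (freeSymbol y ξ * (𝓕 f : L2) ξ) := (i0 y').sub (i0 y)
    have j1 : Integrable fun ξ => weightedSchwartz 1 φ ξ * (freeSymbol y ξ * (𝓕 f : L2) ξ) +
        weightedSchwartz 1 φ ξ * (freeSymbol y' ξ * (𝓕 f : L2) ξ) := (i1 y).add (i1 y')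
    rw [integral_add j0 (j1.const_mul _),
      integral_sub (i0 y') (i0 y), integral_const_mul, integral_add (i1 y) (i1 y'), hT, hT, hX, hX]
    ring
  rw [e, norm_neg]
  have hm : ∀ ξ, 0 ≤ negLaplaceSymbol ξ := fun ξ => by unfold negLaplaceSymbol; positivity
  have hi : Integrable fun ξ => ‖weightedSchwartz 3 φ ξ‖ * ‖(𝓕 f : L2) ξ‖ :=
    ((weightedSchwartz 3 φ).memLp 2 volume).norm.integrable_mul (Lp.memLp (𝓕 f : L2)).norm
  calc _ ≤ ∫ ξ, 5 * |y' - y| ^ 3 * (‖weightedSchwartz 3 φ ξ‖ * ‖(𝓕 f : L2) ξ‖) := by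
        refine norm_integral_le_of_norm_le (hi.const_mul _)
          (Filter.Eventually.of_forall fun ξ => ?_)
        rw [norm_mul, norm_mul, weightedSchwartz_apply, norm_mul, Complex.norm_real,
          Real.norm_of_nonneg (pow_nonneg (hm ξ) 3)]
        refine (mul_le_mul_of_nonneg_left (norm_freeSymbol_trapezoid_le y y' ξ)
          (by positivity)).trans (le_of_eq ?_)
        ring
    _ = 5 * |y' - y| ^ 3 * ∫ ξ, ‖weightedSchwartz 3 φ ξ‖ * ‖(𝓕 f : L2) ξ‖ :=
        integral_const_mul _ _
    _ ≤ 5 * |y' - y| ^ 3 * (√(∫ ξ, ‖weightedSchwartz 3 φ ξ‖ ^ 2) * ‖(𝓕 f : L2)‖) := by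
        gcongr
        exact integral_norm_mul_norm_le _ _
    _ = _ := by rw [Lp.norm_fourier_eq, trapezoidConst]; ring

/-! ### Third absolute moments of Brownian increments -/

/-- The third absolute moment of the standard Gaussian law. -/
def gaussianThirdMoment : ℝ≥0∞ := ∫⁻ x, ENNReal.ofReal (|x| ^ 3) ∂gaussianReal 0 1

theorem gaussianThirdMoment_ne_top : gaussianThirdMoment ≠ ⊤ := by
  have h := (memLp_id_gaussianReal (μ := 0) (v := 1) 3).integrable_norm_pow (p := 3)
    (by norm_num)
  have h2 := h.lintegral_lt_top
  simpa [gaussianThirdMoment] using h2.ne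

theorem lintegral_abs_cube_gaussianReal (v : ℝ≥0) :
    ∫⁻ x, ENNReal.ofReal (|x| ^ 3) ∂gaussianReal 0 v =
      ENNReal.ofReal (√v ^ 3) * gaussianThirdMoment := by
  have h := gaussianReal_map_const_mul (μ := 0) (v := 1) √(v : ℝ)
  have hv : (NNReal.mk (√(v : ℝ) ^ 2) (sq_nonneg _)) * 1 = v := by
    ext
    simp
  rw [mul_zero, hv] at h
  rw [← h, lintegral_map (by fun_prop) (by fun_prop), gaussianThirdMoment,
    ← lintegral_const_mul _ (by fun_prop)]
  refine lintegral_congr fun x => ?_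
  rw [← ENNReal.ofReal_mul (by positivity), abs_mul, abs_of_nonneg (Real.sqrt_nonneg _), mul_pow]

section Brownian

variable {Ω : Type*} [MeasurableSpace Ω] {P : Measure Ω} {W : ℝ≥0 → Ω → ℝ}

theorem lintegral_abs_increment_cube (hW : IsBrownianReal W P) {a b : ℝ≥0} (hab : a ≤ b) :
    ∫⁻ ω, ENNReal.ofReal (|W b ω - W a ω| ^ 3) ∂P =
      ENNReal.ofReal (√((b : ℝ) - a) ^ 3) * gaussianThirdMoment := by
  have h := (hW.hasLaw_sub b a).lintegral_comp (f := fun x => ENNReal.ofReal (|x| ^ 3))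
    (by fun_prop)
  rw [lintegral_abs_cube_gaussianReal] at h
  have e : ((nndist b.1 a.1 : ℝ≥0) : ℝ) = (b : ℝ) - a := by
    rw [coe_nndist, Real.dist_eq]
    exact abs_of_nonneg (sub_nonneg.mpr hab)
  rw [e] at h
  exact h

/-- The third absolute moment of an increment scales like `Δt^{3/2} ≤ δ Δt` when `Δt ≤ δ²`, and the
time steps telescope. -/
theorem lintegral_sum_abs_increment_cube_le (hW : IsBrownianReal W P) {m : ℕ} {τ : ℕ → ℝ≥0}
    (hτ : Monotone τ) {δ : ℝ} (hδ : 0 ≤ δ) (hmesh : ∀ i < m, (τ (i + 1) : ℝ) - τ i ≤ δ ^ 2) :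
    ∫⁻ ω, ∑ i ∈ Finset.range m, ENNReal.ofReal (|W (τ (i + 1)) ω - W (τ i) ω| ^ 3) ∂P ≤
      ENNReal.ofReal (δ * ((τ m : ℝ) - τ 0)) * gaussianThirdMoment := by
  have hme : ∀ i, AEMeasurable (fun ω => ENNReal.ofReal (|W (τ (i + 1)) ω - W (τ i) ω| ^ 3)) P := by
    intro i
    have h1 := hW.aemeasurable (τ (i + 1))
    have h2 := hW.aemeasurable (τ i)
    exact ((continuous_abs.measurable.comp_aemeasurable (h1.sub h2)).pow_const 3).ennreal_ofReal
  have hnn : ∀ i, 0 ≤ (τ (i + 1) : ℝ) - τ i := fun i => by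
    have := hτ (Nat.le_succ i)
    exact sub_nonneg.mpr (by exact_mod_cast this)
  rw [lintegral_finsetSum' _ fun i _ => hme i]
  calc _ ≤ ∑ i ∈ Finset.range m, ENNReal.ofReal (δ * ((τ (i + 1) : ℝ) - τ i)) *
        gaussianThirdMoment := by
        refine Finset.sum_le_sum fun i hi => ?_
        rw [lintegral_abs_increment_cube hW (hτ (Nat.le_succ i))]
        gcongr
        have h1 : √((τ (i + 1) : ℝ) - τ i) ≤ δ :=
          Real.sqrt_le_iff.mpr ⟨hδ, hmesh i (Finset.mem_range.mp hi)⟩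
        calc √((τ (i + 1) : ℝ) - τ i) ^ 3 =
              √((τ (i + 1) : ℝ) - τ i) * √((τ (i + 1) : ℝ) - τ i) ^ 2 := by ring
          _ ≤ δ * √((τ (i + 1) : ℝ) - τ i) ^ 2 := by gcongr
          _ = δ * ((τ (i + 1) : ℝ) - τ i) := by rw [Real.sq_sqrt (hnn i)]
    _ = ENNReal.ofReal (δ * ((τ m : ℝ) - τ 0)) * gaussianThirdMoment := by
        rw [← Finset.sum_mul, ← ENNReal.ofReal_sum_of_nonneg
          (fun i _ => mul_nonneg hδ (hnn i)), ← Finset.mul_sum,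
          Finset.sum_range_sub (fun i => (τ i : ℝ))]

/-- If the trapezoidal rule has an error of third order along the increments of `W`, uniformly in
`ω`, then the Stratonovich integral is the increment of the primitive. -/
theorem hasStratonovichIntegral_of_trapezoid (hW : IsBrownianReal W P)
    {X Y : ℝ≥0 → Ω → ℂ} {C : ℝ} (hC : 0 ≤ C)
    (h : ∀ r r' ω, ‖(X r ω + X r' ω) / 2 * ((W r' ω - W r ω : ℝ) : ℂ) - (Y r' ω - Y r ω)‖ ≤
      C * |W r' ω - W r ω| ^ 3) (a b : ℝ≥0) :
    HasStratonovichIntegral P W X a b fun ω => Y b ω - Y a ω := by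
  intro ε hε η hη
  set K : ℝ := C / ε * |(b : ℝ) - a| * gaussianThirdMoment.toReal with hK
  have hK0 : 0 ≤ K := by positivity
  -- The final Markov bound is `K` times the square root of the mesh bound, here `K η / (K + 1) ≤
  -- η`; the `+ 1` covers `K = 0`.
  refine ⟨(η / (K + 1)) ^ 2, by positivity, fun m τ hτ h0 hm hmesh => ?_⟩
  have hd : 0 ≤ η / (K + 1) := by positivity
  have hme : AEMeasurable (fun ω => ENNReal.ofReal (C / ε) *
      ∑ i ∈ Finset.range m, ENNReal.ofReal (|W (τ (i + 1)) ω - W (τ i) ω| ^ 3)) P := by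
    refine AEMeasurable.const_mul (Finset.aemeasurable_fun_sum _ fun i _ => ?_) _
    exact ((continuous_abs.measurable.comp_aemeasurable
      ((hW.aemeasurable (τ (i + 1))).sub (hW.aemeasurable (τ i)))).pow_const 3).ennreal_ofReal
  -- The increments of `Y` telescope, so the total error is a sum of local ones. No measurability of
  -- `X` or `Y` is assumed; Markov's inequality is applied to the larger set, defined by `W` alone.
  have hsub : {ω | ε ≤ ‖(∑ i ∈ Finset.range m, (X (τ i) ω + X (τ (i + 1)) ω) / 2 *
        ((W (τ (i + 1)) ω - W (τ i) ω : ℝ) : ℂ)) - (Y b ω - Y a ω)‖} ⊆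
      {ω | 1 ≤ ENNReal.ofReal (C / ε) *
        ∑ i ∈ Finset.range m, ENNReal.ofReal (|W (τ (i + 1)) ω - W (τ i) ω| ^ 3)} := by
    intro ω hω
    simp only [Set.mem_ofPred_eq] at hω ⊢
    rw [← ENNReal.ofReal_sum_of_nonneg (fun i _ => by positivity),
      ← ENNReal.ofReal_mul (by positivity), ENNReal.one_le_ofReal]
    have h1 : Y b ω - Y a ω = ∑ i ∈ Finset.range m, (Y (τ (i + 1)) ω - Y (τ i) ω) := by
      rw [Finset.sum_range_sub (fun i => Y (τ i) ω), h0, hm]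
    rw [h1, ← Finset.sum_sub_distrib] at hω
    have h2 := (hω.trans (norm_sum_le _ _)).trans
      (Finset.sum_le_sum fun i _ => h (τ i) (τ (i + 1)) ω)
    rw [← Finset.mul_sum] at h2
    rw [div_mul_eq_mul_div, one_le_div hε]
    exact h2
  calc _ ≤ P {ω | 1 ≤ ENNReal.ofReal (C / ε) *
        ∑ i ∈ Finset.range m, ENNReal.ofReal (|W (τ (i + 1)) ω - W (τ i) ω| ^ 3)} :=
        measure_mono hsub
    _ ≤ ∫⁻ ω, ENNReal.ofReal (C / ε) *
        ∑ i ∈ Finset.range m, ENNReal.ofReal (|W (τ (i + 1)) ω - W (τ i) ω| ^ 3) ∂P := by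
        simpa using mul_meas_ge_le_lintegral₀ hme 1
    _ = ENNReal.ofReal (C / ε) * ∫⁻ ω,
        ∑ i ∈ Finset.range m, ENNReal.ofReal (|W (τ (i + 1)) ω - W (τ i) ω| ^ 3) ∂P :=
        lintegral_const_mul' _ _ ENNReal.ofReal_ne_top
    _ ≤ ENNReal.ofReal (C / ε) *
        (ENNReal.ofReal (η / (K + 1) * |(b : ℝ) - a|) * gaussianThirdMoment) := by
        gcongr
        refine (lintegral_sum_abs_increment_cube_le hW hτ hd hmesh).trans ?_
        rw [h0, hm]
        gcongr
        exact le_abs_self _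
    _ = ENNReal.ofReal (η / (K + 1) * K) := by
        rw [← ENNReal.ofReal_toReal gaussianThirdMoment_ne_top,
          ← ENNReal.ofReal_mul (by positivity), ← ENNReal.ofReal_mul (by positivity), hK]
        congr 1
        ring
    _ ≤ ENNReal.ofReal η := by
        refine ENNReal.ofReal_le_ofReal ?_
        rw [div_mul_eq_mul_div, div_le_iff₀ (by positivity)]
        nlinarith

/-! ### The linear substep as a solution of the Stratonovich equation. -/

theorem norm_lieScheme (σ : ℕ) (T : ℝ≥0) (N : ℕ) (w : ℝ≥0 → ℝ) (n : ℕ) (u : L2) :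
    ‖lieScheme σ T N w n u‖ = ‖u‖ := by
  induction n with
  | zero => rfl
  | succ n ih =>
    have h := charge_lieScheme_succ σ T N w n u
    rw [charge_eq_norm_sq, charge_eq_norm_sq, ih] at h
    exact (sq_eq_sq₀ (norm_nonneg _) (norm_nonneg _)).mp h

theorem norm_lieIntermediate (σ : ℕ) (T : ℝ≥0) (N : ℕ) (w : ℝ≥0 → ℝ) (n : ℕ) (u : L2) :
    ‖lieIntermediate σ T N w n u‖ = ‖u‖ := by
  have h := charge_nlStep σ ((T : ℝ) / N) (lieScheme σ T N w n u)
  rw [charge_eq_norm_sq, charge_eq_norm_sq, norm_lieScheme] at h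
  exact (sq_eq_sq₀ (norm_nonneg _) (norm_nonneg _)).mp h

/-- A norm bound uniform in `ω` makes the trapezoidal constant deterministic, so the random initial
value needs neither adaptedness nor measurability. For the scheme, conservation of charge supplies
the bound. -/
theorem solvesLinearEquation_freeStep (hW : IsBrownianReal W P) (a b : ℝ≥0) {f : Ω → L2} {C : ℝ}
    (hf : ∀ ω, ‖f ω‖ ≤ C) :
    SolvesLinearEquation P W a b fun t ω => freeStep (W t ω - W a ω) (f ω) := by
  refine ⟨?_, fun t _ φ => ?_⟩
  · filter_upwards [hW.cont] with ω hω
    exact ((continuous_freeStep (f ω)).comp (hω.sub continuous_const)).continuousOn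
  · have key : ∀ (r r' : ℝ≥0) (ω : Ω),
        ‖(Complex.I * (Δ (freeStep (W r ω - W a ω) (f ω) : 𝓢'(ℝ, ℂ))) φ +
            Complex.I * (Δ (freeStep (W r' ω - W a ω) (f ω) : 𝓢'(ℝ, ℂ))) φ) / 2 *
          ((W r' ω - W r ω : ℝ) : ℂ) -
        ((freeStep (W r' ω - W a ω) (f ω) : 𝓢'(ℝ, ℂ)) φ -
          (freeStep (W r ω - W a ω) (f ω) : 𝓢'(ℝ, ℂ)) φ)‖ ≤
        trapezoidConst φ * |C| * |W r' ω - W r ω| ^ 3 := by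
      intro r r' ω
      have h := norm_freeStep_trapezoid_le (f ω) φ (W r ω - W a ω) (W r' ω - W a ω)
      rw [sub_sub_sub_cancel_right] at h
      exact h.trans (mul_le_mul_of_nonneg_right (mul_le_mul_of_nonneg_left
        ((hf ω).trans (le_abs_self C)) (trapezoidConst_nonneg φ)) (by positivity))
    have hC : 0 ≤ trapezoidConst φ * |C| := mul_nonneg (trapezoidConst_nonneg φ) (abs_nonneg C)
    exact hasStratonovichIntegral_of_trapezoid hW hC key a t

end Brownian

end WhiteNoiseNLS

end

theorem mainTheorem8 {Ω : Type*} [MeasurableSpace Ω] (P : Measure Ω) [IsProbabilityMeasure P]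
    (W : ℝ≥0 → Ω → ℝ) (hW : IsBrownianReal W P)
    (s : ℝ) (hs : 1 / 2 < s) (σ : ℕ) (T : ℝ≥0) (hT : 0 < T) (N : ℕ) (hN : 0 < N) :
    -- the scheme acts on `H^s`, differentiably, and preserves the symplectic form and the charge
    (∀ᵐ ω ∂P,
      (∀ n ≤ N, ∃ Φ : Hs s → Hs s,
        (∀ u, (Φ u).toL2 = lieScheme σ T N (W · ω) n u.toL2) ∧
        Differentiable ℝ Φ) ∧
      (∀ n ≤ N, Differentiable ℝ
        (fun u : Hs s => lieScheme σ T N (W · ω) n u.toL2)) ∧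
      (∀ n < N, ∀ u h k : Hs s,
        schemeForm s σ T N (W · ω) (n + 1) u h k =
          schemeForm s σ T N (W · ω) n u h k) ∧
      (∀ n < N, ∀ u : L2,
        charge (lieScheme σ T N (W · ω) (n + 1) u) =
          charge (lieScheme σ T N (W · ω) n u))) ∧
    -- the nonlinear substep is the exact flow of the Hamiltonian system of `H₂` in `H^s`
    (∀ u₀ : Hs s, ∃ U : ℝ → Hs s,
      U 0 = u₀ ∧ (∀ t, (U t).toL2 = nlStep σ t u₀.toL2) ∧
      ∀ t, ∃ g : Hs s,
        (∀ᵐ x, g.toL2 x = ((‖(U t).toL2 x‖ ^ (2 * σ) : ℝ) : ℂ) * (U t).toL2 x) ∧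
        HasVariationalDerivative (energyH2 σ) (U t).toL2 g.toL2 ∧
        HasDerivAt U (Complex.I • g) t) ∧
    -- the linear substep solves `du = i Δu ∘ dW` on each `[t_n, t_{n+1}]`
    (∀ n < N, ∀ u₀ : L2,
      SolvesLinearEquation P W (gridTime T N n)
        (gridTime T N (n + 1))
        (fun t ω => freeStep (W t ω - W (gridTime T N n) ω)
          (lieIntermediate σ T N (W · ω) n u₀))) ∧
    -- and `r ↦ exp(i r Δ)` is the exact flow of the Hamiltonian system of `H₁`
    (∀ v : L2, MemSobolev 2 2 (v : 𝓢'(ℝ, ℂ)) →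
      freeStep 0 v = v ∧
      ∀ r : ℝ, ∃ g : L2,
        (g : 𝓢'(ℝ, ℂ)) = Δ (freeStep r v : 𝓢'(ℝ, ℂ)) ∧
        HasVariationalDerivative energyH1
          (freeStep r v) g ∧
        HasDerivAt (fun r : ℝ => freeStep r v) (Complex.I • g) r) ∧
    -- the factors of both substeps are unitary on `L²`
    (∀ (τ : ℝ) (f : L2),
      ∃ M : L2 ≃ₗᵢ[ℂ] L2,
        (∀ h, M h = phaseMul (fun x => τ * ‖f x‖ ^ (2 * σ))
          (aemeasurable_nlPhase σ τ f) h) ∧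
        M f = nlStep σ τ f) ∧
    (∀ r : ℝ, ∃ L : L2 ≃ₗᵢ[ℂ] L2,
      ∀ h, L h = freeStep r h) := by
  -- The almost sure claims about the scheme hold for every `ω`.
  refine ⟨Filter.Eventually.of_forall fun ω => ⟨fun n _ => ?_, fun n _ u => ?_, fun n _ u h k => ?_,
    fun n _ u => ?_⟩, exists_nonlinear_flow hs σ, fun n _ u₀ => ?_, fun v hv => ?_, fun τ f => ?_,
    fun r => ⟨freeStepₗᵢ r, fun _ => rfl⟩⟩
  · exact ⟨lieHs hs σ T N (W · ω) n, toL2_lieHs hs σ T N (W · ω) n,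
      differentiable_lieHs hs σ T N (W · ω) n⟩
  · exact (hasFDerivAt_lieScheme hs σ T N (W · ω) n u).differentiableAt
  · exact schemeForm_succ hs σ T N (W · ω) n u h k
  · exact charge_lieScheme_succ σ T N (W · ω) n u
  · exact solvesLinearEquation_freeStep hW _ _ fun ω =>
      (norm_lieIntermediate σ T N (W · ω) n u₀).le
  · exact ⟨freeStep_zero v, linear_flow hv⟩
  · exact ⟨phaseMulₗᵢ _ (aemeasurable_nlPhase σ τ f), fun _ => rfl, rfl⟩
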